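/- Let $\sigma,\rho>0$. For $n\ge 0$ put $\pi_n=\frac{\sigma+\rho+n}{\sigma+\rho}\,\frac{\rho^n}{n!}$, and let $H(\sigma)$ be the real Hilbert space of sequences $f=(f_n)_{n\ge0}$ with $\sum_n f_n^2\pi_n<\infty$, with scalar product $(f,g)=\sum_n f_ng_n\pi_n$. Let $A(\sigma)=(a_{n,m})_{n,m\ge0}$ be the infinite tridiagonal matrix whose only non-zero entries are $a_{n,n+1}=\frac{\rho}{n+\sigma+\rho}$ $(n\ge0)$ and $a_{n,n-1}=\frac{n}{n+\sigma+\rho}$ $(n\ge1)$. Let $e_0=(1,0,0,\dots)$. Define the polynomials $P_n(\sigma;x)$ by $P_{-1}=0$, $P_0=1$ and $\rho P_{n+1}(\sigma;x)-(n+\sigma+\rho)xP_n(\sigma;x)+nP_{n-1}(\sigma;x)=0$ for $n\ge 0$, put $P(\sigma;x)=(P_n(\sigma;x))_{n\ge0}$, and define the Charlier polynomials $C_n(x;a)$, $a>0$, by $C_{-1}=0$, $C_0=1$ and $aC_{n+1}(x;a)+(x-n-a)C_n(x;a)+nC_{n-1}(x;a)=0$ for $n\ge 0$. For $k\ge0$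 put $$s_k^\pm=\pm\sqrt{\frac{\rho}{\sigma+\rho+k}},\qquad r_k=\frac{\sigma+\rho}{2(\sigma+\rho+k)}\,\frac{(\sigma+\rho+k)^k}{k!}\,e^{-(\sigma+\rho+k)}.$$ Then: 1. The matrix $A(\sigma)$ induces a bounded self-adjoint operator, also denoted $A(\sigma)$, on $H(\sigma)$. 2. $A(\sigma)$ has a unique spectral measure, that is, a unique projection-valued measure $E$ on the Borel sets of $\mathbb R$ with $A(\sigma)=\int x\,dE(x)$. It is purely discrete with atoms at the points $s_k^\pm$, $k\ge0$: $E(\mathbb R\setminus\{s_k^\pm : k\ge 0\})=0$, and the scalar spectral measure $\psi(B)=(E(B)e_0,e_0)$ is $\psi=\sum_{k\ge0}r_k(\delta_{s_k^+}+\delta_{s_k^-})$, so that it has mass $r_k$ at each of $s_k^+$ and $s_k^-$. The measure $\psi$ is also the orthogonality measure of the $P_n$: $\int P_n(\sigma;x)P_m(\sigma;x)\,d\psi(x)=\delta_{n,m}/\pi_n$ for all $n,m\ge0$. 3. The eigenvalues of $A(\sigma)$ are exactly the points $s_k^\pm$, $k\ge 0$. For $x=s_k^\pm$ the vector $P(\sigma;x)$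 belongs to $H(\sigma)$ and is an eigenvector for the eigenvalue $x$; it spans the eigenspace, and $E(\{x\})$ is the orthogonal projection onto its span. 4. For all $n\ge0$ and all real $x\ne0$, $P_n(\sigma;x)=\frac1{x^n}\,C_n\!\left(\frac{\rho-(\sigma+\rho)x^2}{x^2};\frac{\rho}{x^2}\right)$. -/

import Mathlib

open MeasureTheory

noncomputable section

namespace MMInf

/-! ### Projection-valued measures on the real line -/

/-- A projection-valued (spectral) measure on the Borel sets of `ℝ`, with values in the orthogonal
projections of a real Hilbert space. As for Mathlib's vector measures, the value on a
non-measurable set is set to `0`, so that equality means equality on Borel sets. -/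
structure ProjectionValuedMeasure (H : Type*) [NormedAddCommGroup H] [InnerProductSpace ℝ H]
    [CompleteSpace H] where
  proj : Set ℝ → H →L[ℝ] H
  isStarProjection : ∀ B, MeasurableSet B → IsStarProjection (proj B)
  univ : proj Set.univ = 1
  inter : ∀ B C, MeasurableSet B → MeasurableSet C → proj (B ∩ C) = proj B * proj C
  iUnion : ∀ B : ℕ → Set ℝ, (∀ i, MeasurableSet (B i)) →
    Pairwise (fun i j => Disjoint (B i) (B j)) →
    ∀ v : H, HasSum (fun i => proj (B i) v) (proj (⋃ i, B i) v)
  not_measurable : ∀ B, ¬ MeasurableSet B → proj B = 0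

namespace ProjectionValuedMeasure

variable {H : Type*} [NormedAddCommGroup H] [InnerProductSpace ℝ H] [CompleteSpace H]

theorem inner_nonneg (E : ProjectionValuedMeasure H) (v : H) (B : Set ℝ) :
    0 ≤ inner ℝ v (E.proj B v) := by
  by_cases hB : MeasurableSet B
  · have h := E.isStarProjection B hB
    have h1 : E.proj B (E.proj B v) = E.proj B v := by
      have := congrArg (fun T : H →L[ℝ] H => T v) h.isIdempotentElem.eq
      simpa using this
    have h2 : inner ℝ (E.proj B v) (E.proj B v) = inner ℝ v (E.proj B (E.proj B v)) :=
      h.isSelfAdjoint.isSymmetric v (E.proj B v)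
    rw [← h1, ← h2]
    exact real_inner_self_nonneg
  · simp [E.not_measurable B hB]

theorem proj_empty (E : ProjectionValuedMeasure H) : E.proj ∅ = 0 := by
  ext v
  have h := E.iUnion (fun _ => ∅) (fun _ => MeasurableSet.empty) (by intro i j _; simp) v
  simpa using (summable_const_iff _).1 h.summable

/-- The scalar spectral measure `B ↦ (v, E(B) v)` of a vector `v`. -/
def scalarMeasure (E : ProjectionValuedMeasure H) (v : H) : Measure ℝ :=
  Measure.ofMeasurable (fun B _ => ENNReal.ofReal (inner ℝ v (E.proj B v)))
    (by simp [E.proj_empty])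
    (by
      intro B hB hd
      have h : HasSum (fun i => inner ℝ v (E.proj (B i) v)) (inner ℝ v (E.proj (⋃ i, B i) v)) :=
        (E.iUnion B hB hd v).mapL (innerSL ℝ v)
      rw [← h.tsum_eq]
      exact ENNReal.ofReal_tsum_of_nonneg (fun i => E.inner_nonneg v (B i)) h.summable)

/-- `E` is the spectral measure of the bounded self-adjoint operator `A`, that is `A = ∫ x dE(x)`.
Since `A` is symmetric, this identity is the one between the quadratic forms. -/
def IsSpectralMeasureOf (E : ProjectionValuedMeasure H) (A : H →L[ℝ] H) : Prop :=
  IsSelfAdjoint A ∧ ∀ v : H, Integrable (fun x : ℝ => x) (E.scalarMeasure v) ∧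
    inner ℝ v (A v) = ∫ x, x ∂(E.scalarMeasure v)

end ProjectionValuedMeasure

/-! ### The weighted space and the infinite matrix -/

/-- The weights `π_n(σ)`. -/
def weight (σ ρ : ℝ) (n : ℕ) : ℝ := (σ + ρ + n) / (σ + ρ) * (ρ ^ n / n.factorial)

/-- The measure on `ℕ` with mass `π_n(σ)` at `n`. -/
def weightMeasure (σ ρ : ℝ) : Measure ℕ :=
  Measure.sum fun n => ENNReal.ofReal (weight σ ρ n) • Measure.dirac n

/-- The real Hilbert space `H(σ)` of the sequences with `∑ f_n² π_n(σ) < ∞`, with scalar product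
`∑ f_n g_n π_n(σ)`: the space `L²(ℕ, π(σ))`. For `σ, ρ > 0` all weights are positive, so that
its elements are genuine sequences. -/
abbrev HSpace (σ ρ : ℝ) : Type := Lp ℝ 2 (weightMeasure σ ρ)

theorem weightMeasure_singleton (σ ρ : ℝ) (n : ℕ) :
    weightMeasure σ ρ {n} = ENNReal.ofReal (weight σ ρ n) := by
  rw [weightMeasure, Measure.sum_apply _ (measurableSet_singleton n), tsum_eq_single n]
  · simp
  · intro m hm
    simp [hm]

theorem weightMeasure_singleton_ne_top (σ ρ : ℝ) (n : ℕ) : weightMeasure σ ρ {n} ≠ ⊤ := by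
  rw [weightMeasure_singleton]
  exact ENNReal.ofReal_ne_top

/-- The sequence `e_n` whose only non-zero entry is a `1` at index `n`. -/
def basisVec (σ ρ : ℝ) (n : ℕ) : HSpace σ ρ :=
  indicatorConstLp 2 (measurableSet_singleton n) (weightMeasure_singleton_ne_top σ ρ n) (1 : ℝ)

/-- The entries `a_{n,m}(σ)` of the infinite tridiagonal matrix `A(σ)`. -/
def matrixEntry (σ ρ : ℝ) (n m : ℕ) : ℝ :=
  if m = n + 1 then ρ / (n + σ + ρ) else if n = m + 1 then n / (n + σ + ρ) else 0

/-! ### The polynomials -/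

/-- The Charlier polynomials `C_n(x; a)`: `C_{-1} = 0`, `C_0 = 1` and
`a C_{n+1} + (x - n - a) C_n + n C_{n-1} = 0`. -/
def charlier (a x : ℝ) : ℕ → ℝ
  | 0 => 1
  | 1 => (a - x) / a
  | n + 2 => (((n + 1 : ℝ) + a - x) * charlier a x (n + 1) - (n + 1 : ℝ) * charlier a x n) / a

/-- The polynomials `P_n(σ; x)`: `P_{-1} = 0`, `P_0 = 1` and
`ρ P_{n+1} - (n + σ + ρ) x P_n + n P_{n-1} = 0`. -/
def polyP (σ ρ x : ℝ) : ℕ → ℝ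
  | 0 => 1
  | 1 => (σ + ρ) * x / ρ
  | n + 2 =>
    (((n + 1 : ℝ) + σ + ρ) * x * polyP σ ρ x (n + 1) - (n + 1 : ℝ) * polyP σ ρ x n) / ρ

/-! ### The atoms and the masses -/

/-- `s_k^+(σ)`; the other atom of index `k` is `s_k^-(σ) = - s_k^+(σ)`. -/
def atom (σ ρ : ℝ) (k : ℕ) : ℝ := √(ρ / (σ + ρ + k))

/-- The set of all `s_k^±(σ)`. -/
def atoms (σ ρ : ℝ) : Set ℝ := {x | ∃ k : ℕ, x = atom σ ρ k ∨ x = -atom σ ρ k}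

/-- `r_k(σ)`. -/
def mass (σ ρ : ℝ) (k : ℕ) : ℝ :=
  (σ + ρ) / (2 * (σ + ρ + k)) * ((σ + ρ + k) ^ k / k.factorial) * Real.exp (-(σ + ρ + k))

/-- The discrete measure `∑_k r_k(σ) (δ_{s_k^+(σ)} + δ_{s_k^-(σ)})`. -/
def discreteMeasure (σ ρ : ℝ) : Measure ℝ :=
  Measure.sum fun k : ℕ =>
    ENNReal.ofReal (mass σ ρ k) • (Measure.dirac (atom σ ρ k) + Measure.dirac (-atom σ ρ k))

end MMInf

end

namespace MMInf

open scoped InnerProductSpace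

/-! By detailed balance, π_n a_{n,n+1} = π_{n+1} a_{n+1,n}, so A = T + T* on H(σ), where T is the
weighted shift given by the superdiagonal. Its coefficients tend to zero, so T is a norm limit of
finite-rank operators and A is compact and self-adjoint: its eigenvectors span a dense subspace.
Read row by row, A f = x f is the recurrence of the P_n, so the eigenvectors are the nonzero
multiples of P(σ; x), and x is an eigenvalue exactly when P(σ; x) has finite norm
(`apply_eq_smul_iff`).

For x ≠ 0 the exponential generating function of the P_n is e^{t/x} (1 - xt/ρ)^y with y = ρ/x² - (σ
+ ρ). Finite norm makes it entire, which forces y to be a natural number k, that is, x = s_k^±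
(`exists_sq_eq_of_summable`). Conversely, at these points P_n = x^{-n} C_n(k; a) with a = σ + ρ + k,
and the duality C_n(k; a) = C_k(n; a) turns the squared norm into a Poisson moment, equal to 1/r_k
(`hasSum_weight_mul_polyP_sq`).

Hence the vectors √r_k P(σ; s_k^±) form a Hilbert basis in which A is diagonal. Parseval applied to
e_n and e_m gives the orthogonality relations, and e_0 gives ψ. Any spectral measure of A commutes
with A, so its projection at an eigenvalue fixes the eigenvectors there; this determines it on the
basis (`eq_diagonalPVM`). -/

theorem integrable_sum_dirac {X ι : Type*} [MeasurableSpace X] {lam : ι → X}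
    {c : ι → ℝ} (hc : ∀ i, 0 ≤ c i) {f : X → ℝ} (hf : Measurable f)
    (h : Summable fun i => c i * f (lam i)) :
    Integrable f (Measure.sum fun i => ENNReal.ofReal (c i) • Measure.dirac (lam i)) := by
  refine ⟨hf.aestronglyMeasurable, ?_⟩
  rw [HasFiniteIntegral, lintegral_sum_measure]
  simp only [lintegral_smul_measure, lintegral_dirac' _ hf.enorm]
  have h2 : ∀ i, ENNReal.ofReal (c i) • ‖f (lam i)‖ₑ = ENNReal.ofReal ‖c i * f (lam i)‖ := by
    intro i
    rw [norm_mul, Real.norm_of_nonneg (hc i), ENNReal.ofReal_mul (hc i), smul_eq_mul,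
      ofReal_norm]
  simp only [h2]
  exact h.norm.tsum_ofReal_lt_top

theorem integral_sum_dirac {X ι : Type*} [MeasurableSpace X] {lam : ι → X}
    {c : ι → ℝ} (hc : ∀ i, 0 ≤ c i) {f : X → ℝ} (hf : Measurable f) {x : ℝ}
    (h : HasSum (fun i => c i * f (lam i)) x) :
    ∫ t, f t ∂(Measure.sum fun i => ENNReal.ofReal (c i) • Measure.dirac (lam i)) = x := by
  have h1 := hasSum_integral_measure (integrable_sum_dirac hc hf h.summable)
  refine h1.unique ?_
  convert! h using 2 with i
  rw [integral_smul_measure, integral_dirac' _ _ hf.stronglyMeasurable, ENNReal.toReal_ofReal (hc i), smul_eq_mul]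

/-! ### Projection-valued measures diagonal in a Hilbert basis -/

section Diagonal

variable {H ι : Type*} [NormedAddCommGroup H] [InnerProductSpace ℝ H] [CompleteSpace H]

omit [CompleteSpace H] in
theorem _root_.HilbertBasis.clm_ext (b : HilbertBasis ι ℝ H) {S T : H →L[ℝ] H}
    (h : ∀ i, S (b i) = T (b i)) : S = T := by
  refine ContinuousLinearMap.ext_on (s := Set.range b) ?_ ?_
  · rw [Submodule.dense_iff_topologicalClosure_eq_top]
    exact b.dense_span
  · rintro _ ⟨i, rfl⟩
    exact h i

omit [CompleteSpace H] in
theorem _root_.HilbertBasis.hasSum_clm (b : HilbertBasis ι ℝ H) (T : H →L[ℝ] H) (v : H) :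
    HasSum (fun i => ⟪b i, v⟫_ℝ • T (b i)) (T v) := by
  have h := (b.hasSum_repr v).mapL T
  simpa [b.repr_apply_apply] using h

/-- The closed span of the vectors of a family whose labels lie in `B`. -/
def closedSpanOf (b : ι → H) (lam : ι → ℝ) (B : Set ℝ) : Submodule ℝ H :=
  (Submodule.span ℝ (b '' (lam ⁻¹' B))).topologicalClosure

instance (b : ι → H) (lam : ι → ℝ) (B : Set ℝ) : CompleteSpace (closedSpanOf b lam B) := by
  unfold closedSpanOf
  infer_instance

theorem starProjection_closedSpanOf_of_mem (b : ι → H) (lam : ι → ℝ) {B : Set ℝ} {i : ι}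
    (hi : lam i ∈ B) : (closedSpanOf b lam B).starProjection (b i) = b i := by
  rw [Submodule.starProjection_eq_self_iff]
  exact Submodule.le_topologicalClosure _ (Submodule.subset_span ⟨i, hi, rfl⟩)

theorem starProjection_closedSpanOf_of_notMem {b : ι → H} (hb : Orthonormal ℝ b) (lam : ι → ℝ)
    {B : Set ℝ} {i : ι} (hi : lam i ∉ B) : (closedSpanOf b lam B).starProjection (b i) = 0 := by
  rw [Submodule.starProjection_apply_eq_zero_iff, closedSpanOf, Submodule.orthogonal_closure,
    Submodule.mem_orthogonal]
  intro u hu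
  have hle : Submodule.span ℝ (b '' (lam ⁻¹' B)) ≤ (ℝ ∙ b i)ᗮ := by
    rw [Submodule.span_le]
    rintro _ ⟨j, hj, rfl⟩
    rw [SetLike.mem_coe, Submodule.mem_orthogonal_singleton_iff_inner_right]
    refine hb.2 ?_
    rintro rfl
    exact hi hj
  rw [real_inner_comm]
  exact Submodule.mem_orthogonal_singleton_iff_inner_right.1 (hle hu)

/-- Each `i` satisfies `P j i` for at most one `j`, so the nonzero terms of the single sum match
those of the double sum over `(j, i)`, which is then summed by fibres. This is countable additivity
of the diagonal measure. -/
theorem hasSum_disjoint_union {E : Type*} [AddCommGroup E] [TopologicalSpace E]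
    [IsTopologicalAddGroup E] [RegularSpace E] {g : ι → E} {P : ℕ → ι → Prop}
    [∀ j i, Decidable (P j i)] [∀ i, Decidable (∃ j, P j i)]
    (hP : ∀ i j k, P j i → P k i → j = k) {x : E} {y : ℕ → E}
    (hx : HasSum (fun i => if ∃ j, P j i then g i else 0) x)
    (hy : ∀ j, HasSum (fun i => if P j i then g i else 0) (y j)) : HasSum y x := by
  have key : HasSum (fun p : ℕ × ι => if P p.1 p.2 then g p.2 else 0) x := by
    refine (hasSum_iff_hasSum_of_ne_zero_bij (f := fun i => if ∃ j, P j i then g i else 0)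
      (g := fun p : ℕ × ι => if P p.1 p.2 then g p.2 else 0)
      (fun p => p.1.2) ?_ ?_ ?_).1 hx
    · rintro ⟨⟨j, i⟩, h⟩ ⟨⟨k, l⟩, h'⟩ (e : i = l)
      subst e
      have h1 : P j i := by by_contra hn; simp [hn] at h
      have h2 : P k i := by by_contra hn; simp [hn] at h'
      cases hP i j k h1 h2
      rfl
    · intro i hi
      have h1 : ∃ j, P j i := by by_contra hn; simp [hn] at hi
      obtain ⟨j, hj⟩ := h1
      have hg : g i ≠ 0 := by
        intro h0
        simp [h0] at hi
      exact ⟨⟨(j, i), by simp [hj, hg]⟩, rfl⟩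
    · rintro ⟨⟨j, i⟩, h⟩
      have h1 : P j i := by by_contra hn; simp [hn] at h
      have h2 : ∃ j, P j i := ⟨j, h1⟩
      simp [h1, h2]
  exact key.prod_fiberwise hy

open Classical in
/-- The projection-valued measure of the operator that is diagonal with diagonal entries `lam`
in a Hilbert basis. -/
noncomputable def diagonalPVM (b : HilbertBasis ι ℝ H) (lam : ι → ℝ) :
    ProjectionValuedMeasure H where
  proj B := if MeasurableSet B then (closedSpanOf b lam B).starProjection else 0
  isStarProjection B hB := by
    rw [if_pos hB]
    exact isStarProjection_starProjection
  univ := by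
    rw [if_pos MeasurableSet.univ]
    exact b.clm_ext fun i => starProjection_closedSpanOf_of_mem b lam (Set.mem_univ _)
  inter B C hB hC := by
    rw [if_pos hB, if_pos hC, if_pos (hB.inter hC)]
    refine b.clm_ext fun i => ?_
    rw [mul_apply_eq_comp]
    by_cases h2 : lam i ∈ C
    · rw [starProjection_closedSpanOf_of_mem b lam h2]
      by_cases h1 : lam i ∈ B
      · rw [starProjection_closedSpanOf_of_mem b lam h1,
          starProjection_closedSpanOf_of_mem b lam (B := B ∩ C) ⟨h1, h2⟩]
      · rw [starProjection_closedSpanOf_of_notMem b.orthonormal lam h1,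
          starProjection_closedSpanOf_of_notMem b.orthonormal lam fun h => h1 h.1]
    · rw [starProjection_closedSpanOf_of_notMem b.orthonormal lam h2, map_zero,
        starProjection_closedSpanOf_of_notMem b.orthonormal lam fun h => h2 h.2]
  iUnion B hB hd v := by
    have hs : ∀ C : Set ℝ, HasSum (fun i => if lam i ∈ C then ⟪b i, v⟫_ℝ • b i else 0)
        ((closedSpanOf b lam C).starProjection v) := by
      intro C
      convert! b.hasSum_clm (closedSpanOf b lam C).starProjection v using 2 with i
      by_cases h : lam i ∈ C
      · rw [if_pos h, starProjection_closedSpanOf_of_mem b lam h]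
      · rw [if_neg h, starProjection_closedSpanOf_of_notMem b.orthonormal lam h, smul_zero]
    simp only [if_pos (hB _), if_pos (MeasurableSet.iUnion hB)]
    refine hasSum_disjoint_union (g := fun i => ⟪b i, v⟫_ℝ • b i) (P := fun j i => lam i ∈ B j)
      ?_ ?_ fun j => hs (B j)
    · intro i j k hj hk
      by_contra hne
      exact Set.disjoint_left.1 (hd hne) hj hk
    · simpa only [Set.mem_iUnion] using hs (⋃ j, B j)
  not_measurable B hB := if_neg hB

theorem diagonalPVM_apply_of_mem (b : HilbertBasis ι ℝ H) (lam : ι → ℝ) {B : Set ℝ}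
    (hB : MeasurableSet B) {i : ι} (hi : lam i ∈ B) : (diagonalPVM b lam).proj B (b i) = b i := by
  rw [diagonalPVM]
  simp only [if_pos hB]
  exact starProjection_closedSpanOf_of_mem b lam hi

theorem diagonalPVM_apply_of_notMem (b : HilbertBasis ι ℝ H) (lam : ι → ℝ) {B : Set ℝ}
    (hB : MeasurableSet B) {i : ι} (hi : lam i ∉ B) : (diagonalPVM b lam).proj B (b i) = 0 := by
  rw [diagonalPVM]
  simp only [if_pos hB]
  exact starProjection_closedSpanOf_of_notMem b.orthonormal lam hi

/-! ### Action of a spectral measure on eigenvectors -/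

namespace ProjectionValuedMeasure

theorem scalarMeasure_apply (E : ProjectionValuedMeasure H) (v : H) {B : Set ℝ}
    (hB : MeasurableSet B) : E.scalarMeasure v B = ENNReal.ofReal ⟪v, E.proj B v⟫_ℝ :=
  Measure.ofMeasurable_apply B hB

theorem proj_proj (E : ProjectionValuedMeasure H) {B C : Set ℝ} (hB : MeasurableSet B)
    (hC : MeasurableSet C) (v : H) : E.proj B (E.proj C v) = E.proj (B ∩ C) v := by
  rw [E.inter B C hB hC]
  rfl

theorem inner_proj_left (E : ProjectionValuedMeasure H) {B : Set ℝ} (hB : MeasurableSet B)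
    (v w : H) : ⟪E.proj B v, w⟫_ℝ = ⟪v, E.proj B w⟫_ℝ :=
  (E.isStarProjection B hB).isSelfAdjoint.isSymmetric v w

theorem scalarMeasure_proj (E : ProjectionValuedMeasure H) {B : Set ℝ} (hB : MeasurableSet B)
    (v : H) : E.scalarMeasure (E.proj B v) = (E.scalarMeasure v).restrict B := by
  ext C hC
  rw [Measure.restrict_apply hC, E.scalarMeasure_apply _ hC, E.scalarMeasure_apply _ (hC.inter hB),
    E.inner_proj_left hB, E.proj_proj hC hB, E.proj_proj hB (hC.inter hB), Set.inter_comm C B,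
    ← Set.inter_assoc, Set.inter_self]

theorem proj_add_proj_compl (E : ProjectionValuedMeasure H) {B : Set ℝ} (hB : MeasurableSet B)
    (v : H) : E.proj B v + E.proj Bᶜ v = v := by
  -- Finite additivity comes from countable additivity along B, Bᶜ, ∅, ∅, ….
  have h := E.iUnion (fun n => if n = 0 then B else if n = 1 then Bᶜ else ∅)
    (fun i => by split_ifs <;> simp [hB]) (by
      intro i j hij
      rcases eq_or_ne i 0 with rfl | hi
      · rcases eq_or_ne j 1 with rfl | hj
        · simpa using disjoint_compl_right
        · simp [hij.symm, hj]
      · rcases eq_or_ne j 0 with rfl | hj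
        · rcases eq_or_ne i 1 with rfl | hi1
          · simpa using disjoint_compl_left
          · simp [hi, hi1]
        · rcases eq_or_ne i 1 with rfl | hi1
          · simp [hij.symm, hj]
          · simp [hi, hi1]) v
  have hU : (⋃ n : ℕ, if n = 0 then B else if n = 1 then Bᶜ else ∅) = Set.univ := by
    refine Set.eq_univ_of_forall fun x => ?_
    by_cases hx : x ∈ B
    · exact Set.mem_iUnion.2 ⟨0, by simpa using hx⟩
    · exact Set.mem_iUnion.2 ⟨1, by simpa using hx⟩
  rw [hU, E.univ] at h
  have h2 : HasSum (fun i : ℕ => E.proj (if i = 0 then B else if i = 1 then Bᶜ else ∅) v)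
      (∑ i ∈ Finset.range 2, E.proj (if i = 0 then B else if i = 1 then Bᶜ else ∅) v) :=
    hasSum_sum_of_ne_finset_zero (by
      intro i hi
      have h0 : i ≠ 0 := by rintro rfl; simp at hi
      have h1 : i ≠ 1 := by rintro rfl; simp at hi
      simp [h0, h1, E.proj_empty])
  have h3 := h2.unique h
  simpa [Finset.sum_range_succ] using h3

/-- The spectral projections commute with the operator. -/
theorem IsSpectralMeasureOf.apply_proj {E : ProjectionValuedMeasure H} {A : H →L[ℝ] H}
    (h : E.IsSpectralMeasureOf A) {B : Set ℝ} (hB : MeasurableSet B) (v : H) :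
    A (E.proj B v) = E.proj B (A v) := by
  have hsymm : ∀ x y, ⟪A x, y⟫_ℝ = ⟪x, A y⟫_ℝ := fun x y => h.1.isSymmetric x y
  -- The quadratic forms at E(B)u and E(Bᶜ)u are the integrals over B and Bᶜ, which add up to the
  -- form at u; the cross terms must vanish.
  have hcross : ∀ u, ⟪E.proj B u, A (E.proj Bᶜ u)⟫_ℝ = 0 := by
    intro u
    have h1 := (h.2 (E.proj B u)).2
    have h2 := (h.2 (E.proj Bᶜ u)).2
    rw [E.scalarMeasure_proj hB] at h1
    rw [E.scalarMeasure_proj hB.compl] at h2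
    have h3 := integral_add_compl hB (h.2 u).1
    rw [← h1, ← h2, ← (h.2 u).2] at h3
    have h4 : ⟪u, A u⟫_ℝ = ⟪E.proj B u + E.proj Bᶜ u, A (E.proj B u + E.proj Bᶜ u)⟫_ℝ := by
      rw [E.proj_add_proj_compl hB]
    rw [map_add, inner_add_left, inner_add_right, inner_add_right, ← hsymm (E.proj Bᶜ u),
      real_inner_comm (E.proj B u) (A (E.proj Bᶜ u))] at h4
    linarith
  -- Applying the previous step to E(B)u + E(Bᶜ)w decouples the two vectors.
  have hcross2 : ∀ u w, ⟪E.proj B u, A (E.proj Bᶜ w)⟫_ℝ = 0 := by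
    intro u w
    have h1 := hcross (E.proj B u + E.proj Bᶜ w)
    simpa [E.proj_proj hB hB, E.proj_proj hB hB.compl, E.proj_proj hB.compl hB,
      E.proj_proj hB.compl hB.compl, E.proj_empty] using h1
  have hc1 : E.proj B (A (E.proj Bᶜ v)) = 0 := by
    rw [← inner_self_eq_zero (𝕜 := ℝ), E.inner_proj_left hB, E.proj_proj hB hB, Set.inter_self,
      ← E.inner_proj_left hB]
    exact hcross2 _ _
  have hc2 : E.proj Bᶜ (A (E.proj B v)) = 0 := by
    rw [← inner_self_eq_zero (𝕜 := ℝ), E.inner_proj_left hB.compl, E.proj_proj hB.compl hB.compl,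
      Set.inter_self, hsymm, real_inner_comm, hsymm, real_inner_comm, hsymm]
    exact hcross2 _ _
  have e1 := E.proj_add_proj_compl hB (A (E.proj B v))
  rw [hc2, add_zero] at e1
  rw [← e1]
  conv_rhs => rw [← E.proj_add_proj_compl hB v, map_add, map_add, hc1, add_zero]

theorem scalarMeasure_finite (E : ProjectionValuedMeasure H) (v : H) :
    IsFiniteMeasure (E.scalarMeasure v) :=
  ⟨by rw [E.scalarMeasure_apply v MeasurableSet.univ]; exact ENNReal.ofReal_lt_top⟩

theorem scalarMeasure_real (E : ProjectionValuedMeasure H) (v : H) {B : Set ℝ}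
    (hB : MeasurableSet B) : (E.scalarMeasure v).real B = ⟪v, E.proj B v⟫_ℝ := by
  rw [measureReal_def, E.scalarMeasure_apply v hB, ENNReal.toReal_ofReal (E.inner_nonneg v B)]

theorem norm_proj_sq (E : ProjectionValuedMeasure H) (v : H) {B : Set ℝ}
    (hB : MeasurableSet B) : ⟪E.proj B v, E.proj B v⟫_ℝ = (E.scalarMeasure v).real B := by
  rw [E.scalarMeasure_real v hB, E.inner_proj_left hB, E.proj_proj hB hB, Set.inter_self]

/-- The spectral projection of a set on one side of an eigenvalue kills its eigenvectors. -/
theorem IsSpectralMeasureOf.proj_eigenvector_eq_zero {E : ProjectionValuedMeasure H}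
    {A : H →L[ℝ] H} (h : E.IsSpectralMeasureOf A) {v : H} {c ε : ℝ} (hv : A v = c • v)
    {B : Set ℝ} (hB : MeasurableSet B) (hpos : ∀ x ∈ B, 0 < ε * (x - c)) : E.proj B v = 0 := by
  have := E.scalarMeasure_finite v
  have hint : Integrable (fun x : ℝ => ε * (x - c)) ((E.scalarMeasure v).restrict B) :=
    (((h.2 v).1.sub (integrable_const c)).const_mul ε).restrict
  have h1 := (h.2 (E.proj B v)).2
  rw [h.apply_proj hB, hv, map_smul, inner_smul_right, E.norm_proj_sq v hB,
    E.scalarMeasure_proj hB] at h1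
  -- E(B)v is mapped by A to c E(B)v, so the mean of x - c over B vanishes; the integrand being
  -- positive on B, the scalar measure of B is zero.
  have h2 : ∫ x in B, ε * (x - c) ∂(E.scalarMeasure v) = 0 := by
    rw [integral_const_mul, integral_sub (h.2 v).1.restrict (integrable_const c), ← h1]
    simp
    right
    ring
  have h3 : (fun x : ℝ => ε * (x - c)) =ᵐ[(E.scalarMeasure v).restrict B] 0 :=
    (setIntegral_eq_zero_iff_of_nonneg_ae
      ((ae_restrict_mem hB).mono fun x hx => (hpos x hx).le) hint).1 h2
  have h4 : (E.scalarMeasure v).restrict B = 0 := by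
    rw [← ae_eq_bot, ← Filter.eventually_false_iff_eq_bot]
    filter_upwards [h3, ae_restrict_mem hB] with x hx hxB
    exact (hpos x hxB).ne' hx
  rw [Measure.restrict_eq_zero] at h4
  rw [← inner_self_eq_zero (𝕜 := ℝ), E.norm_proj_sq v hB, measureReal_def, h4]
  rfl

theorem IsSpectralMeasureOf.proj_eigenvector {E : ProjectionValuedMeasure H} {A : H →L[ℝ] H}
    (h : E.IsSpectralMeasureOf A) {v : H} {c : ℝ} (hv : A v = c • v) : E.proj {c} v = v := by
  have h1 : E.proj (Set.Ioi c) v = 0 :=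
    h.proj_eigenvector_eq_zero (ε := 1) hv measurableSet_Ioi fun x hx => by
      have : c < x := hx
      linarith
  have h2 : E.proj (Set.Iio c) v = 0 :=
    h.proj_eigenvector_eq_zero (ε := -1) hv measurableSet_Iio fun x hx => by
      have : x < c := hx
      linarith
  have h3 := E.proj_add_proj_compl (measurableSet_Ioi (a := c)) v
  have h4 := E.proj_add_proj_compl (measurableSet_Iio (a := c)) (E.proj (Set.Ioi c)ᶜ v)
  rw [h1, zero_add] at h3
  rw [E.proj_proj measurableSet_Iio.compl measurableSet_Ioi.compl, h3, h2, zero_add] at h4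
  convert! h4 using 3
  ext x
  simp [le_antisymm_iff, and_comm]

theorem IsSpectralMeasureOf.proj_eigenvector_of_mem {E : ProjectionValuedMeasure H}
    {A : H →L[ℝ] H} (h : E.IsSpectralMeasureOf A) {v : H} {c : ℝ} (hv : A v = c • v) {B : Set ℝ}
    (hB : MeasurableSet B) (hc : c ∈ B) : E.proj B v = v := by
  rw [← h.proj_eigenvector hv, E.proj_proj hB (measurableSet_singleton c),
    Set.inter_eq_right.2 (Set.singleton_subset_iff.2 hc)]

theorem IsSpectralMeasureOf.proj_eigenvector_of_notMem {E : ProjectionValuedMeasure H}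
    {A : H →L[ℝ] H} (h : E.IsSpectralMeasureOf A) {v : H} {c : ℝ} (hv : A v = c • v) {B : Set ℝ}
    (hB : MeasurableSet B) (hc : c ∉ B) : E.proj B v = 0 := by
  rw [← h.proj_eigenvector hv, E.proj_proj hB (measurableSet_singleton c),
    Set.inter_singleton_eq_empty.2 hc, E.proj_empty]
  rfl

theorem ext_proj {E F : ProjectionValuedMeasure H}
    (h : ∀ B, MeasurableSet B → E.proj B = F.proj B) : E = F := by
  have : E.proj = F.proj := by
    funext B
    by_cases hB : MeasurableSet B
    · exact h B hB
    · rw [E.not_measurable B hB, F.not_measurable B hB]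
  cases E
  cases F
  congr

end ProjectionValuedMeasure

variable (b : HilbertBasis ι ℝ H) (lam : ι → ℝ)

theorem scalarMeasure_diagonalPVM (v : H) :
    (diagonalPVM b lam).scalarMeasure v =
      Measure.sum fun i => ENNReal.ofReal (⟪b i, v⟫_ℝ ^ 2) • Measure.dirac (lam i) := by
  ext B hB
  rw [ProjectionValuedMeasure.scalarMeasure_apply _ _ hB, Measure.sum_apply _ hB]
  have hs : HasSum (fun i => ⟪b i, v⟫_ℝ ^ 2 * B.indicator 1 (lam i))
      ⟪v, (diagonalPVM b lam).proj B v⟫_ℝ := by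
    have h := (b.hasSum_clm ((diagonalPVM b lam).proj B) v).mapL (innerSL ℝ v)
    convert! h using 2 with i
    by_cases hi : lam i ∈ B
    · rw [diagonalPVM_apply_of_mem b lam hB hi]
      simp [hi, real_inner_comm, sq]
    · rw [diagonalPVM_apply_of_notMem b lam hB hi]
      simp [hi]
  rw [← hs.tsum_eq, ENNReal.ofReal_tsum_of_nonneg _ hs.summable]
  · congr 1 with i
    rw [ENNReal.ofReal_mul (sq_nonneg _)]
    by_cases hi : lam i ∈ B <;> simp [hB, hi]
  · intro i
    exact mul_nonneg (sq_nonneg _) (Set.indicator_nonneg (fun _ _ => zero_le_one) _)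

variable {b lam}

omit [CompleteSpace H] in
theorem hasSum_inner_diagonal {A : H →L[ℝ] H} (hA : ∀ i, A (b i) = lam i • b i) (v : H) :
    HasSum (fun i => ⟪b i, v⟫_ℝ ^ 2 * lam i) ⟪v, A v⟫_ℝ := by
  have h := (b.hasSum_clm A v).mapL (innerSL ℝ v)
  convert! h using 2 with i
  simp [hA, real_inner_comm, sq]
  ring

theorem isSpectralMeasureOf_diagonalPVM {A : H →L[ℝ] H} (hA' : IsSelfAdjoint A)
    (hA : ∀ i, A (b i) = lam i • b i) : (diagonalPVM b lam).IsSpectralMeasureOf A := by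
  refine ⟨hA', fun v => ?_⟩
  have h := hasSum_inner_diagonal hA v
  rw [scalarMeasure_diagonalPVM]
  exact ⟨integrable_sum_dirac (fun i => sq_nonneg _) measurable_id h.summable,
    (integral_sum_dirac (fun i => sq_nonneg _) measurable_id h).symm⟩

theorem eq_diagonalPVM {A : H →L[ℝ] H} (hA : ∀ i, A (b i) = lam i • b i)
    {E : ProjectionValuedMeasure H} (hE : E.IsSpectralMeasureOf A) : E = diagonalPVM b lam := by
  refine ProjectionValuedMeasure.ext_proj fun B hB => b.clm_ext fun i => ?_
  by_cases hi : lam i ∈ B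
  · rw [diagonalPVM_apply_of_mem b lam hB hi, hE.proj_eigenvector_of_mem (hA i) hB hi]
  · rw [diagonalPVM_apply_of_notMem b lam hB hi, hE.proj_eigenvector_of_notMem (hA i) hB hi]

end Diagonal

/-! ### The weights and coordinates in the weighted space -/

theorem weight_pos {σ ρ : ℝ} (hσ : 0 < σ) (hρ : 0 < ρ) (n : ℕ) : 0 < weight σ ρ n := by
  unfold weight
  positivity

theorem weight_zero {σ ρ : ℝ} (hσ : 0 < σ) (hρ : 0 < ρ) : weight σ ρ 0 = 1 := by
  have : σ + ρ ≠ 0 := by positivity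
  simp [weight, this]

/-- Detailed balance: it makes the subdiagonal of the matrix the adjoint of the superdiagonal. -/
theorem weight_symm {σ ρ : ℝ} (hσ : 0 < σ) (hρ : 0 < ρ) (n : ℕ) :
    weight σ ρ n * (ρ / (n + σ + ρ)) =
      weight σ ρ (n + 1) * (((n + 1 : ℕ) : ℝ) / ((n + 1 : ℕ) + σ + ρ)) := by
  have h1 : (n : ℝ) + σ + ρ ≠ 0 := by positivity
  have h2 : ((n + 1 : ℕ) : ℝ) + σ + ρ ≠ 0 := by positivity
  have h3 : σ + ρ ≠ 0 := by positivity
  rw [weight, weight, Nat.factorial_succ]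
  push_cast at h2 ⊢
  have h4 : (n : ℝ) + 1 ≠ 0 := by positivity
  have h5 : ((n.factorial : ℕ) : ℝ) ≠ 0 := by positivity
  have h6 : σ + ρ + (n : ℝ) = n + σ + ρ := by ring
  have h7 : σ + ρ + ((n : ℝ) + 1) = n + 1 + σ + ρ := by ring
  rw [h6, h7]
  field_simp
  ring

/-- Every point has positive mass, so elements of `HSpace` can be handled pointwise as sequences. -/
theorem ae_weightMeasure_iff {σ ρ : ℝ} (hσ : 0 < σ) (hρ : 0 < ρ) {p : ℕ → Prop} :
    (∀ᵐ n ∂(weightMeasure σ ρ), p n) ↔ ∀ n, p n := by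
  refine ⟨fun h n => ?_, fun h => Filter.Eventually.of_forall h⟩
  by_contra hn
  have h1 : weightMeasure σ ρ {n} = 0 :=
    measure_mono_null (Set.singleton_subset_iff.2 hn) (ae_iff.1 h)
  rw [weightMeasure_singleton, ENNReal.ofReal_eq_zero] at h1
  exact absurd (weight_pos hσ hρ n) (not_lt.2 h1)

namespace HSpace

variable {σ ρ : ℝ}

theorem ext_coe {f g : HSpace σ ρ} (h : ∀ n, f n = g n) : f = g :=
  Lp.ext (Filter.Eventually.of_forall h)

variable (hσ : 0 < σ) (hρ : 0 < ρ)

include hσ hρ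

theorem add_apply (f g : HSpace σ ρ) (n : ℕ) : (f + g : HSpace σ ρ) n = f n + g n :=
  (ae_weightMeasure_iff hσ hρ).1 (Lp.coeFn_add f g) n

theorem smul_apply (c : ℝ) (f : HSpace σ ρ) (n : ℕ) : (c • f : HSpace σ ρ) n = c * f n :=
  (ae_weightMeasure_iff hσ hρ).1 (Lp.coeFn_smul c f) n

theorem zero_apply (n : ℕ) : (0 : HSpace σ ρ) n = 0 :=
  (ae_weightMeasure_iff hσ hρ).1 (Lp.coeFn_zero ℝ 2 (weightMeasure σ ρ)) n

theorem basisVec_apply (n m : ℕ) : basisVec σ ρ n m = if m = n then 1 else 0 := by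
  have h := (ae_weightMeasure_iff hσ hρ).1 (indicatorConstLp_coeFn (p := 2) (c := (1 : ℝ))
    (hs := measurableSet_singleton n) (hμs := weightMeasure_singleton_ne_top σ ρ n)) m
  rw [basisVec, h]
  by_cases hm : m = n <;> simp [hm]

theorem memLp_of_summable {u : ℕ → ℝ} (hu : Summable fun n => weight σ ρ n * u n ^ 2) :
    MemLp u 2 (weightMeasure σ ρ) := by
  rw [memLp_two_iff_integrable_sq (measurable_of_countable u).aestronglyMeasurable]
  exact integrable_sum_dirac (lam := fun n : ℕ => n) (f := fun n => u n ^ 2)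
    (fun n => (weight_pos hσ hρ n).le) (measurable_of_countable _) hu

theorem exists_of_summable {u : ℕ → ℝ} (hu : Summable fun n => weight σ ρ n * u n ^ 2) :
    ∃ f : HSpace σ ρ, ∀ n, f n = u n :=
  ⟨(memLp_of_summable hσ hρ hu).toLp u,
    (ae_weightMeasure_iff hσ hρ).1 (MemLp.coeFn_toLp (memLp_of_summable hσ hρ hu))⟩

theorem hasSum_inner (f g : HSpace σ ρ) :
    HasSum (fun n => weight σ ρ n * (f n * g n)) ⟪f, g⟫_ℝ := by
  rw [L2.inner_def]
  have h := hasSum_integral_measure (show Integrable (fun n => ⟪f n, g n⟫_ℝ)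
    (Measure.sum fun n => ENNReal.ofReal (weight σ ρ n) • Measure.dirac n) from
      L2.integrable_inner f g)
  convert! h using 2 with n
  rw [integral_smul_measure, integral_dirac, ENNReal.toReal_ofReal (weight_pos hσ hρ n).le,
    smul_eq_mul]
  simp [mul_comm]

theorem hasSum_norm_sq (f : HSpace σ ρ) :
    HasSum (fun n => weight σ ρ n * f n ^ 2) (‖f‖ ^ 2) := by
  have h := hasSum_inner hσ hρ f f
  rw [real_inner_self_eq_norm_sq] at h
  simpa only [sq] using h

theorem inner_basisVec (n : ℕ) (f : HSpace σ ρ) : ⟪basisVec σ ρ n, f⟫_ℝ = weight σ ρ n * f n := by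
  have h := hasSum_single (f := fun m => weight σ ρ m * (basisVec σ ρ n m * f m)) n fun m hm => by
    simp [basisVec_apply hσ hρ, hm]
  simpa [basisVec_apply hσ hρ] using (hasSum_inner hσ hρ (basisVec σ ρ n) f).unique h

end HSpace

/-! ### The weighted shift and the compact operator of the matrix -/

namespace HSpace

section Shift

variable {σ ρ : ℝ} (hσ : 0 < σ) (hρ : 0 < ρ)

include hσ hρ

/-- Detailed balance trades one of the two factors ρ/(n+σ+ρ) for the subdiagonal entry
(n+1)/(n+1+σ+ρ) ≤ 1, at the price of moving the weight to n + 1. -/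
theorem weight_mul_shift_sq_le (x : ℝ) (n : ℕ) :
    weight σ ρ n * (ρ / (n + σ + ρ) * x) ^ 2 ≤
      ρ / (n + σ + ρ) * (weight σ ρ (n + 1) * x ^ 2) := by
  have h1 : weight σ ρ n * (ρ / (n + σ + ρ) * x) ^ 2 =
      (((n + 1 : ℕ) : ℝ) / ((n + 1 : ℕ) + σ + ρ)) *
        (ρ / (n + σ + ρ) * (weight σ ρ (n + 1) * x ^ 2)) := by
    linear_combination (ρ / (n + σ + ρ) * x ^ 2) * weight_symm hσ hρ n
  rw [h1]
  refine mul_le_of_le_one_left ?_ ?_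
  · have := weight_pos hσ hρ (n + 1)
    positivity
  · rw [div_le_one (by positivity)]
    linarith

theorem ratio_le_one (n : ℕ) : ρ / (n + σ + ρ) ≤ 1 := by
  rw [div_le_one (by positivity)]
  have : (0 : ℝ) ≤ n := n.cast_nonneg
  linarith

theorem summable_shift (f : HSpace σ ρ) :
    Summable fun n => weight σ ρ n * (ρ / (n + σ + ρ) * f (n + 1)) ^ 2 := by
  refine Summable.of_nonneg_of_le (fun n => ?_) (fun n => ?_)
    ((summable_nat_add_iff 1).2 (hasSum_norm_sq hσ hρ f).summable)
  · have := weight_pos hσ hρ n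
    positivity
  · refine (weight_mul_shift_sq_le hσ hρ _ n).trans (mul_le_of_le_one_left ?_ (ratio_le_one hσ hρ n))
    have := weight_pos hσ hρ (n + 1)
    positivity

/-- The bound `c` is only asked for on the support of `f`, so that it becomes small for sequences
vanishing up to a large index. -/
theorem norm_sq_le_of_shift {f g : HSpace σ ρ} (hg : ∀ n, g n = ρ / (n + σ + ρ) * f (n + 1))
    {c : ℝ} (hc : ∀ n : ℕ, f (n + 1) ≠ 0 → ρ / (n + σ + ρ) ≤ c) (hc0 : 0 ≤ c) :
    ‖g‖ ^ 2 ≤ c * ‖f‖ ^ 2 := by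
  have hf := (hasSum_norm_sq hσ hρ f)
  have h1 := (hasSum_norm_sq hσ hρ g)
  have h2 := ((summable_nat_add_iff 1).2 hf.summable).hasSum
  have h3 : ∑' n, weight σ ρ (n + 1) * f (n + 1) ^ 2 ≤ ‖f‖ ^ 2 := by
    rw [← hf.tsum_eq, hf.summable.tsum_eq_zero_add]
    have := weight_pos hσ hρ 0
    exact le_add_of_nonneg_left (by positivity)
  refine (hasSum_le (fun n => ?_) h1 (h2.mul_left c)).trans (mul_le_mul_of_nonneg_left h3 hc0)
  rw [hg]
  refine (weight_mul_shift_sq_le hσ hρ _ n).trans ?_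
  by_cases h0 : f (n + 1) = 0
  · simp [h0]
  · refine mul_le_mul_of_nonneg_right (hc n h0) ?_
    have := weight_pos hσ hρ (n + 1)
    positivity

theorem exists_shift :
    ∃ T : HSpace σ ρ →L[ℝ] HSpace σ ρ, ∀ f n, T f n = ρ / (n + σ + ρ) * f (n + 1) := by
  choose S hS using fun f : HSpace σ ρ => exists_of_summable hσ hρ (summable_shift hσ hρ f)
  let L : HSpace σ ρ →ₗ[ℝ] HSpace σ ρ :=
    { toFun := S
      map_add' := fun f g => ext_coe fun n => by
        rw [add_apply hσ hρ, hS, hS, hS, add_apply hσ hρ, mul_add]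
      map_smul' := fun c f => ext_coe fun n => by
        rw [RingHom.id_apply, smul_apply hσ hρ, hS, hS, smul_apply hσ hρ]
        ring }
  refine ⟨L.mkContinuous 1 fun f => ?_, hS⟩
  have h := norm_sq_le_of_shift hσ hρ (hS f) (fun n _ => ratio_le_one hσ hρ n) zero_le_one
  rw [one_mul] at h ⊢
  exact le_of_sq_le_sq h (norm_nonneg f)

variable (σ ρ) in
/-- The span of the basis vectors of index at most `N`. -/
noncomputable def truncation (N : ℕ) : Submodule ℝ (HSpace σ ρ) :=
  Submodule.span ℝ (Set.range fun i : Fin (N + 1) => basisVec σ ρ i)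

omit hσ hρ in
instance (N : ℕ) : FiniteDimensional ℝ (truncation σ ρ N) := by
  exact FiniteDimensional.span_of_finite ℝ (Set.finite_range _)

theorem sub_truncation_apply (f : HSpace σ ρ) {N m : ℕ} (hm : m ≤ N) :
    (f - (truncation σ ρ N).starProjection f : HSpace σ ρ) m = 0 := by
  have h := (Submodule.mem_orthogonal _ _).1
    ((truncation σ ρ N).sub_starProjection_mem_orthogonal f) (basisVec σ ρ m)
    (Submodule.subset_span ⟨⟨m, Nat.lt_succ_of_le hm⟩, rfl⟩)
  rw [inner_basisVec hσ hρ] at h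
  exact (mul_eq_zero.1 h).resolve_left (weight_pos hσ hρ m).ne'

omit hσ hρ in
theorem norm_sub_truncation_le (f : HSpace σ ρ) (N : ℕ) :
    ‖f - (truncation σ ρ N).starProjection f‖ ≤ ‖f‖ := by
  rw [← Submodule.starProjection_orthogonal_val]
  exact Submodule.norm_starProjection_apply_le _ f

open ContinuousLinearMap in
-- Truncating to the first N + 1 coordinates before applying T gives finite-rank operators; the
-- error sees only the tail coefficients, hence tends to zero in norm. Taking adjoints is continuous
-- and preserves finite rank.
theorem isCompactOperator_add_adjoint {T : HSpace σ ρ →L[ℝ] HSpace σ ρ}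
    (hT : ∀ f n, T f n = ρ / (n + σ + ρ) * f (n + 1)) : IsCompactOperator (T + adjoint T) := by
  let D : ℕ → HSpace σ ρ →L[ℝ] HSpace σ ρ := fun N => T ∘L (truncation σ ρ N).starProjection
  have hcP : ∀ N, IsCompactOperator (truncation σ ρ N).starProjection := fun N =>
    have : ProperSpace (truncation σ ρ N) := FiniteDimensional.proper ℝ _
    (isCompactOperator_of_locallyCompactSpace_dom
      (truncation σ ρ N).orthogonalProjectionOnto).clm_comp (truncation σ ρ N).subtypeL
  have hbound : ∀ N : ℕ, ‖D N - T‖ ≤ √(ρ / (N + σ + ρ)) := by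
    intro N
    refine opNorm_le_bound _ (Real.sqrt_nonneg _) fun f => ?_
    have h0 : (D N - T) f = -T (f - (truncation σ ρ N).starProjection f) := by
      simp [D]
    rw [h0, norm_neg]
    have h1 := norm_sq_le_of_shift hσ hρ (hT (f - (truncation σ ρ N).starProjection f))
      (c := ρ / (N + σ + ρ)) (fun n hn => by
        -- The tail vanishes at indices up to N, and the shift reads index n + 1.
        have hN : N ≤ n := by
          by_contra hlt
          exact hn (sub_truncation_apply hσ hρ f (by omega))
        gcongr) (by positivity)
    refine le_of_sq_le_sq (h1.trans ?_) (by positivity)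
    rw [mul_pow, Real.sq_sqrt (by positivity)]
    gcongr
    exact norm_sub_truncation_le f N
  have hlim : Filter.Tendsto (fun N : ℕ => √(ρ / (N + σ + ρ))) Filter.atTop (nhds 0) := by
    have h1 : Filter.Tendsto (fun N : ℕ => (N : ℝ) + σ + ρ) Filter.atTop Filter.atTop :=
      Filter.tendsto_atTop_add_const_right _ _
        (Filter.tendsto_atTop_add_const_right _ _ tendsto_natCast_atTop_atTop)
    simpa using (h1.const_div_atTop ρ).sqrt
  have hD : Filter.Tendsto D Filter.atTop (nhds T) :=
    tendsto_iff_norm_sub_tendsto_zero.2 (squeeze_zero (fun _ => norm_nonneg _) hbound hlim)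
  have hD' : Filter.Tendsto (fun N => D N + adjoint (D N)) Filter.atTop (nhds (T + adjoint T)) :=
    hD.add ((adjoint.continuous.tendsto T).comp hD)
  refine isCompactOperator_of_tendsto hD' (Filter.Eventually.of_forall fun N => ?_)
  have h1 : IsCompactOperator (D N) := (hcP N).clm_comp T
  have h2 : IsCompactOperator (adjoint (D N)) := by
    have : adjoint (D N) = (truncation σ ρ N).starProjection ∘L adjoint T := by
      rw [adjoint_comp, isSelfAdjoint_iff'.1 (isSelfAdjoint_starProjection _)]
    rw [this]
    exact (hcP N).comp_clm (adjoint T)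
  exact h1.add h2

open ContinuousLinearMap in
theorem adjoint_shift_zero {T : HSpace σ ρ →L[ℝ] HSpace σ ρ}
    (hT : ∀ f n, T f n = ρ / (n + σ + ρ) * f (n + 1)) (f : HSpace σ ρ) : adjoint T f 0 = 0 := by
  have h := inner_basisVec hσ hρ 0 (adjoint T f)
  have h0 : T (basisVec σ ρ 0) = 0 := ext_coe fun n => by
    rw [hT, basisVec_apply hσ hρ, zero_apply hσ hρ]
    simp
  rw [adjoint_inner_right, h0, inner_zero_left] at h
  exact (mul_eq_zero.1 h.symm).resolve_left (weight_pos hσ hρ 0).ne'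

open ContinuousLinearMap in
theorem adjoint_shift_succ {T : HSpace σ ρ →L[ℝ] HSpace σ ρ}
    (hT : ∀ f n, T f n = ρ / (n + σ + ρ) * f (n + 1)) (f : HSpace σ ρ) (n : ℕ) :
    adjoint T f (n + 1) = ((n + 1 : ℕ) : ℝ) / ((n + 1 : ℕ) + σ + ρ) * f n := by
  have h := inner_basisVec hσ hρ (n + 1) (adjoint T f)
  have h0 : T (basisVec σ ρ (n + 1)) = (ρ / (n + σ + ρ)) • basisVec σ ρ n := ext_coe fun m => by
    rw [hT, smul_apply hσ hρ, basisVec_apply hσ hρ, basisVec_apply hσ hρ]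
    by_cases hm : m = n
    · subst hm
      simp
    · simp [hm]
  rw [adjoint_inner_right, h0, inner_smul_left, inner_basisVec hσ hρ] at h
  simp only [conj_trivial] at h
  refine mul_left_cancel₀ (weight_pos hσ hρ (n + 1)).ne' ?_
  linear_combination -h + f n * weight_symm hσ hρ n

theorem exists_matrix_operator : ∃ A : HSpace σ ρ →L[ℝ] HSpace σ ρ,
    IsSelfAdjoint A ∧ IsCompactOperator A ∧
      (∀ f, A f 0 = ρ / (σ + ρ) * f 1) ∧
      (∀ f (n : ℕ), A f (n + 1) = ρ / ((n + 1 : ℕ) + σ + ρ) * f (n + 2) +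
        ((n + 1 : ℕ) : ℝ) / ((n + 1 : ℕ) + σ + ρ) * f n) := by
  obtain ⟨T, hT⟩ := exists_shift hσ hρ
  refine ⟨T + ContinuousLinearMap.adjoint T, ?_, isCompactOperator_add_adjoint hσ hρ hT,
    fun f => ?_, fun f n => ?_⟩
  · exact IsSelfAdjoint.add_star_self T
  · rw [_root_.add_apply, add_apply hσ hρ, hT, adjoint_shift_zero hσ hρ hT]
    simp
  · rw [_root_.add_apply, add_apply hσ hρ, hT, adjoint_shift_succ hσ hρ hT]

end Shift

end HSpace

theorem tsum_matrixEntry_zero (σ ρ : ℝ) (u : ℕ → ℝ) :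
    ∑' m, matrixEntry σ ρ 0 m * u m = ρ / (σ + ρ) * u 1 := by
  rw [tsum_eq_single 1]
  · simp [matrixEntry]
  · intro m hm
    simp [matrixEntry, hm]

theorem tsum_matrixEntry_succ (σ ρ : ℝ) (u : ℕ → ℝ) (n : ℕ) :
    ∑' m, matrixEntry σ ρ (n + 1) m * u m = ρ / ((n + 1 : ℕ) + σ + ρ) * u (n + 2) +
      ((n + 1 : ℕ) : ℝ) / ((n + 1 : ℕ) + σ + ρ) * u n := by
  rw [tsum_eq_sum (s := {n + 2, n})]
  · rw [Finset.sum_pair (by omega)]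
    have h : n ≠ n + 1 + 1 := by omega
    simp [matrixEntry, h]
  · intro m hm
    simp only [Finset.mem_insert, Finset.mem_singleton, not_or] at hm
    have h1 : m ≠ n + 1 + 1 := hm.1
    have h2 : n + 1 ≠ m + 1 := by omega
    rw [matrixEntry, if_neg h1, if_neg h2, zero_mul]

/-! ### Charlier polynomials and their duality -/

theorem polyP_eq_charlier {σ ρ : ℝ} (hρ : 0 < ρ) {x : ℝ} (hx : x ≠ 0) (n : ℕ) :
    polyP σ ρ x n = 1 / x ^ n * charlier (ρ / x ^ 2) ((ρ - (σ + ρ) * x ^ 2) / x ^ 2) n := by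
  induction n using Nat.twoStepInduction with
  | zero => simp [polyP, charlier]
  | one =>
    rw [polyP, charlier]
    field_simp
    ring
  | more n h1 h2 =>
    rw [polyP, charlier, h1, h2]
    field_simp
    ring

/-- The Charlier polynomials at a natural number `k`, as polynomials of degree `k` in the index. -/
noncomputable def charlierDual (a : ℝ) : ℕ → ℕ → ℝ
  | 0, _ => 1
  -- The truncated n - 1 at n = 0 is harmless because its coefficient vanishes.
  | k + 1, n => charlierDual a k n - n / a * charlierDual a k (n - 1)

theorem charlierDual_zero_right (a : ℝ) (k : ℕ) : charlierDual a k 0 = 1 := by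
  induction k with
  | zero => rfl
  | succ k ih => simp [charlierDual, ih]

theorem charlierDual_succ_succ (a : ℝ) (k n : ℕ) :
    charlierDual a (k + 1) (n + 1) =
      charlierDual a k (n + 1) - (n + 1) / a * charlierDual a k n := by
  rw [charlierDual]
  push_cast
  rfl

/-- The forward shift relation. -/
theorem charlierDual_forward (a : ℝ) (k n : ℕ) :
    charlierDual a (k + 1) (n + 1) =
      charlierDual a (k + 1) n - (k + 1) / a * charlierDual a k n := by
  induction k generalizing n with
  | zero =>
    simp [charlierDual]
    ring
  | succ k ih =>
    cases n with
    | zero =>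
      rw [charlierDual_succ_succ, ih]
      simp only [charlierDual_zero_right]
      push_cast
      ring
    | succ n =>
      rw [charlierDual_succ_succ a (k + 1) (n + 1), charlierDual_succ_succ a (k + 1) n]
      push_cast
      linear_combination ih (n + 1) + (k + 1) / a * charlierDual_succ_succ a k n -
        (n + 1) / a * ih n

/-- Two forward shifts, at n + 1 and n, eliminate the terms of degree k from the defining backward
shift. -/
theorem charlierDual_recurrence {a : ℝ} (ha : a ≠ 0) (k n : ℕ) :
    a * charlierDual a k (n + 2) =
      (n + 1 + a - k) * charlierDual a k (n + 1) - (n + 1) * charlierDual a k n := by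
  cases k with
  | zero =>
    simp [charlierDual]
  | succ k =>
    have h1 := charlierDual_forward a k (n + 1)
    have h2 := charlierDual_forward a k n
    have h3 := charlierDual_succ_succ a k n
    field_simp at h1 h2 h3
    push_cast
    refine mul_left_cancel₀ ha ?_
    linear_combination a * h1 + (k + 1) * h3 - (n + 1) * h2

theorem charlier_natCast {a : ℝ} (ha : a ≠ 0) (k n : ℕ) :
    charlier a k n = charlierDual a k n := by
  induction n using Nat.twoStepInduction with
  | zero => rw [charlierDual_zero_right, charlier]
  | one =>
    rw [charlier]
    cases k with
    | zero => simp [charlierDual, ha]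
    | succ k =>
      rw [charlierDual_forward a k 0]
      simp only [charlierDual_zero_right]
      field_simp
      push_cast
      ring
  | more n h1 h2 =>
    rw [charlier, h1, h2, div_eq_iff ha, mul_comm _ a, charlierDual_recurrence ha]

/-! ### Sums against the Poisson weights -/

/-- Sequences of at most exponential growth. -/
def ExpBounded (u : ℕ → ℝ) : Prop := ∃ C B : ℝ, 1 ≤ B ∧ ∀ n, |u n| ≤ C * B ^ n

namespace ExpBounded

variable {u v : ℕ → ℝ}

theorem const (c : ℝ) : ExpBounded fun _ => c := ⟨|c|, 1, le_rfl, by simp⟩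

theorem natCast : ExpBounded fun n => (n : ℝ) :=
  ⟨1, 2, one_le_two, fun n => by
    rw [Nat.abs_cast, one_mul]
    exact_mod_cast Nat.lt_two_pow_self.le⟩

theorem mul (hu : ExpBounded u) (hv : ExpBounded v) : ExpBounded fun n => u n * v n := by
  obtain ⟨C, B, hB, h⟩ := hu
  obtain ⟨C', B', hB', h'⟩ := hv
  refine ⟨C * C', B * B', one_le_mul_of_one_le_of_one_le hB hB', fun n => ?_⟩
  rw [abs_mul, mul_pow, mul_mul_mul_comm]
  exact mul_le_mul (h n) (h' n) (abs_nonneg _) ((abs_nonneg _).trans (h n))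

theorem add (hu : ExpBounded u) (hv : ExpBounded v) : ExpBounded fun n => u n + v n := by
  obtain ⟨C, B, hB, h⟩ := hu
  obtain ⟨C', B', hB', h'⟩ := hv
  have hC : 0 ≤ C := by simpa using (abs_nonneg _).trans (h 0)
  have hC' : 0 ≤ C' := by simpa using (abs_nonneg _).trans (h' 0)
  refine ⟨C + C', max B B', hB.trans (le_max_left _ _), fun n => ?_⟩
  rw [add_mul]
  refine (abs_add_le _ _).trans (add_le_add ((h n).trans ?_) ((h' n).trans ?_))
  · gcongr
    exact le_max_left _ _
  · gcongr
    exact le_max_right _ _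

theorem pred (hu : ExpBounded u) : ExpBounded fun n => u (n - 1) := by
  obtain ⟨C, B, hB, h⟩ := hu
  have hC : 0 ≤ C := by simpa using (abs_nonneg _).trans (h 0)
  refine ⟨C, B, hB, fun n => (h _).trans ?_⟩
  gcongr
  exact Nat.sub_le n 1

theorem succ (hu : ExpBounded u) : ExpBounded fun n => u (n + 1) := by
  obtain ⟨C, B, hB, h⟩ := hu
  exact ⟨C * B, B, hB, fun n => (h _).trans (by rw [pow_succ]; linarith)⟩

theorem charlierDual (a : ℝ) (k : ℕ) : ExpBounded (charlierDual a k) := by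
  induction k with
  | zero => exact const 1
  | succ k ih =>
    convert! ih.add (((const (-1 / a)).mul natCast).mul ih.pred) using 2 with n
    rw [MMInf.charlierDual]
    ring

/-- The factorial absorbs geometric growth; this justifies splitting and shifting all the Poisson
sums below. -/
theorem summable (hu : ExpBounded u) (a : ℝ) :
    Summable fun n => u n * (a ^ n / n.factorial) := by
  obtain ⟨C, B, hB, h⟩ := hu
  refine Summable.of_norm_bounded
    ((Real.summable_pow_div_factorial (B * |a|)).mul_left C) fun n => ?_
  rw [norm_mul, Real.norm_eq_abs, norm_div, norm_pow, Real.norm_natCast, Real.norm_eq_abs, mul_pow,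
    mul_div_assoc, ← mul_assoc]
  gcongr
  exact h n

end ExpBounded

/-- The (unnormalized) Poisson expectation of a sequence. -/
noncomputable def poissonSum (a : ℝ) (u : ℕ → ℝ) : ℝ := ∑' n, u n * (a ^ n / n.factorial)

theorem poissonSum_one (a : ℝ) : poissonSum a (fun _ => 1) = Real.exp a := by
  simp only [poissonSum, one_mul]
  rw [Real.exp_eq_exp_ℝ]
  exact (NormedSpace.expSeries_div_hasSum_exp a).tsum_eq

theorem poissonSum_const_mul (a c : ℝ) (u : ℕ → ℝ) :
    poissonSum a (fun n => c * u n) = c * poissonSum a u := by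
  simp only [poissonSum, mul_assoc, tsum_mul_left]

theorem poissonSum_add {a : ℝ} {u v : ℕ → ℝ} (hu : ExpBounded u) (hv : ExpBounded v) :
    poissonSum a (fun n => u n + v n) = poissonSum a u + poissonSum a v := by
  simp only [poissonSum, add_mul]
  exact (hu.summable a).tsum_add (hv.summable a)

theorem poissonSum_natCast_mul {a : ℝ} {u : ℕ → ℝ} (hu : ExpBounded u) :
    poissonSum a (fun n => n * u n) = a * poissonSum a (fun n => u (n + 1)) := by
  rw [poissonSum, ((ExpBounded.natCast.mul hu).summable a).tsum_eq_zero_add, poissonSum,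
    ← tsum_mul_left]
  simp only [Nat.cast_zero, zero_mul, zero_add]
  refine tsum_congr fun n => ?_
  rw [Nat.factorial_succ, pow_succ]
  push_cast
  have h1 : (n : ℝ) + 1 ≠ 0 := by positivity
  have h2 : (n.factorial : ℝ) ≠ 0 := by positivity
  field_simp

/-- Summation by parts: for the Poisson weights, the backward shift raising k is adjoint to the
negative forward difference. -/
theorem poissonSum_charlierDual_succ_mul {a : ℝ} (ha : a ≠ 0) {g : ℕ → ℝ} (hg : ExpBounded g)
    (k : ℕ) : poissonSum a (fun n => charlierDual a (k + 1) n * g n) =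
      poissonSum a (fun n => charlierDual a k n * (g n - g (n + 1))) := by
  have hq := ExpBounded.charlierDual a k
  have h1 : (fun n => charlierDual a (k + 1) n * g n) = fun n =>
      charlierDual a k n * g n + -1 / a * (n * (charlierDual a k (n - 1) * g n)) := by
    funext n
    rw [charlierDual]
    ring
  have h2 : (fun n => charlierDual a k n * (g n - g (n + 1))) = fun n =>
      charlierDual a k n * g n + -1 * (charlierDual a k n * g (n + 1)) := by
    funext n
    ring
  rw [h1, h2, poissonSum_add (hq.mul hg)
      ((ExpBounded.const _).mul (ExpBounded.natCast.mul (hq.pred.mul hg))),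
    poissonSum_add (hq.mul hg) ((ExpBounded.const _).mul (hq.mul hg.succ)), poissonSum_const_mul,
    poissonSum_const_mul, poissonSum_natCast_mul (hq.pred.mul hg)]
  simp only [Nat.add_sub_cancel]
  field_simp

theorem poissonSum_charlierDual_succ_mul_self {a : ℝ} (ha : a ≠ 0) (k : ℕ) :
    poissonSum a (fun n => charlierDual a (k + 1) n * charlierDual a k n) = 0 := by
  induction k with
  | zero =>
    rw [poissonSum_charlierDual_succ_mul ha (ExpBounded.charlierDual a 0)]
    simp [charlierDual, poissonSum]
  | succ k ih =>
    rw [poissonSum_charlierDual_succ_mul ha (ExpBounded.charlierDual a (k + 1))]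
    have h : (fun n => charlierDual a (k + 1) n *
        (charlierDual a (k + 1) n - charlierDual a (k + 1) (n + 1))) =
        fun n => (k + 1) / a * (charlierDual a (k + 1) n * charlierDual a k n) := by
      funext n
      rw [charlierDual_forward]
      ring
    rw [h, poissonSum_const_mul, ih, mul_zero]

theorem poissonSum_charlierDual_sq {a : ℝ} (ha : a ≠ 0) (k : ℕ) :
    poissonSum a (fun n => charlierDual a k n ^ 2) = Real.exp a * k.factorial / a ^ k := by
  induction k with
  | zero => simp [charlierDual, poissonSum_one]
  | succ k ih =>
    simp only [sq (charlierDual a (k + 1) _)]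
    rw [poissonSum_charlierDual_succ_mul ha (ExpBounded.charlierDual a (k + 1))]
    have h : (fun n => charlierDual a k n *
        (charlierDual a (k + 1) n - charlierDual a (k + 1) (n + 1))) =
        fun n => (k + 1) / a * (charlierDual a k n ^ 2) := by
      funext n
      rw [charlierDual_forward]
      ring
    rw [h, poissonSum_const_mul, ih, Nat.factorial_succ, pow_succ]
    push_cast
    field_simp

/-- The factor n shifts the index; expanding the shifted square by the forward relation leaves the
norms of degrees k and k - 1, as the cross term vanishes by orthogonality. -/
theorem poissonSum_natCast_mul_charlierDual_sq {a : ℝ} (ha : a ≠ 0) (k : ℕ) :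
    poissonSum a (fun n => n * charlierDual a k n ^ 2) =
      (a + k) * poissonSum a (fun n => charlierDual a k n ^ 2) := by
  have hq := ExpBounded.charlierDual a
  have hsq : ∀ k, ExpBounded fun n => charlierDual a k n ^ 2 := fun k => by
    simpa only [sq] using (hq k).mul (hq k)
  rw [poissonSum_natCast_mul (hsq k)]
  cases k with
  | zero => simp [charlierDual]
  | succ k =>
    have h : (fun n => charlierDual a (k + 1) (n + 1) ^ 2) = fun n =>
        charlierDual a (k + 1) n ^ 2 +
          (-2 * ((k + 1) / a) * (charlierDual a (k + 1) n * charlierDual a k n) +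
            ((k + 1) / a) ^ 2 * charlierDual a k n ^ 2) := by
      funext n
      rw [charlierDual_forward]
      ring
    have h1 : ExpBounded fun n =>
        -2 * ((k + 1) / a) * (charlierDual a (k + 1) n * charlierDual a k n) :=
      (ExpBounded.const _).mul ((hq (k + 1)).mul (hq k))
    have h2 : ExpBounded fun n => ((k + 1) / a) ^ 2 * charlierDual a k n ^ 2 :=
      (ExpBounded.const _).mul (hsq k)
    rw [h, poissonSum_add (hsq (k + 1)) (h1.add h2), poissonSum_add h1 h2, poissonSum_const_mul,
      poissonSum_const_mul, poissonSum_charlierDual_succ_mul_self ha,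
      poissonSum_charlierDual_sq ha, poissonSum_charlierDual_sq ha, Nat.factorial_succ, pow_succ]
    push_cast
    field_simp
    ring

/-! ### Norms of the eigenvectors -/

theorem polyP_eq_charlierDual {σ ρ : ℝ} (hσ : 0 < σ) (hρ : 0 < ρ) {x : ℝ} {k : ℕ}
    (hx : x ^ 2 = ρ / (σ + ρ + k)) (n : ℕ) :
    polyP σ ρ x n = 1 / x ^ n * charlierDual (σ + ρ + k) k n := by
  have hs : σ + ρ + k ≠ 0 := by positivity
  have hx0 : x ≠ 0 := by
    rintro rfl
    have : 0 < ρ / (σ + ρ + k) := by positivity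
    rw [← hx] at this
    simp at this
  have h1 : ρ / x ^ 2 = σ + ρ + k := by
    rw [hx]
    field_simp
  have h2 : (ρ - (σ + ρ) * x ^ 2) / x ^ 2 = k := by
    rw [hx]
    field_simp
    ring
  rw [polyP_eq_charlier hρ hx0, h1, h2, charlier_natCast hs]

theorem mass_pos {σ ρ : ℝ} (hσ : 0 < σ) (hρ : 0 < ρ) (k : ℕ) : 0 < mass σ ρ k := by
  unfold mass
  positivity

/-- Since ρ/x² = a, the terms are (1 + n/(σ+ρ)) C_k(n; a)² a^n/n!. The two Poisson moments add up
with the factor (σ+ρ + a + k)/(σ+ρ) = 2a/(σ+ρ), whence the 2 in r_k. -/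
theorem hasSum_weight_mul_polyP_sq {σ ρ : ℝ} (hσ : 0 < σ) (hρ : 0 < ρ) {x : ℝ} {k : ℕ}
    (hx : x ^ 2 = ρ / (σ + ρ + k)) :
    HasSum (fun n => weight σ ρ n * polyP σ ρ x n ^ 2) (1 / mass σ ρ k) := by
  have hs : 0 < σ + ρ := by positivity
  have ha : 0 < σ + ρ + k := by positivity
  set a := σ + ρ + k with haa
  have hq := ExpBounded.charlierDual a k
  have hsq : ExpBounded fun n => charlierDual a k n ^ 2 := by simpa only [sq] using hq.mul hq
  have hns := ExpBounded.natCast.mul hsq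
  have hsum := ((hsq.summable a).hasSum.add
    ((hns.summable a).hasSum.mul_left (1 / (σ + ρ))))
  convert! hsum using 1
  · funext n
    rw [polyP_eq_charlierDual hσ hρ hx, weight, mul_pow, one_div, ← haa, inv_pow, ← pow_mul,
      mul_comm n 2, pow_mul, hx, div_pow]
    field_simp
  · change _ = poissonSum a _ + 1 / (σ + ρ) * poissonSum a _
    rw [poissonSum_natCast_mul_charlierDual_sq ha.ne', poissonSum_charlierDual_sq ha.ne', mass,
      ← haa, Real.exp_neg]
    have : (k.factorial : ℝ) ≠ 0 := by positivity
    field_simp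
    rw [haa]
    ring

/-! ### Generating functions and the exclusion of other eigenvalues -/

/-- A solution of `(n + 1) h (n + 1) = c (n - y) h n` with `h n * (2 / c) ^ n → 0` vanishes
somewhere, so that `y` is a natural number. -/
theorem exists_natCast_eq_of_hypergeometric {h : ℕ → ℝ} {c y : ℝ} (hc : c ≠ 0) (h0 : h 0 ≠ 0)
    (hrec : ∀ n : ℕ, (n + 1) * h (n + 1) = c * (n - y) * h n)
    (hlim : Filter.Tendsto (fun n => h n * (2 / c) ^ n) Filter.atTop (nhds 0)) :
    ∃ k : ℕ, y = k := by
  by_contra! hy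
  have hne : ∀ n, h n ≠ 0 := by
    intro n
    induction n with
    | zero => exact h0
    | succ n ih =>
      intro hz
      have h1 := hrec n
      rw [hz, mul_zero, eq_comm, mul_eq_zero, mul_eq_zero] at h1
      rcases h1 with (h1 | h1) | h1
      · exact hc h1
      · exact hy n (by linarith)
      · exact ih h1
  -- The `h n` are the coefficients of a multiple of (1 - ct)^y, and 2/c lies beyond the singularity
  -- 1/c: the ratio 2(n - y)/(n + 1) of consecutive terms is at least 1 once n ≥ 2y + 1.
  obtain ⟨N, hN⟩ := exists_nat_ge (2 * |y| + 1)
  have hmono : ∀ n, N ≤ n → |h n * (2 / c) ^ n| ≤ |h (n + 1) * (2 / c) ^ (n + 1)| := by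
    intro n hn
    have hn' : 2 * |y| + 1 ≤ n := hN.trans (by exact_mod_cast hn)
    have hpos : (0 : ℝ) < n + 1 := by positivity
    have h1 : h (n + 1) * (2 / c) ^ (n + 1) = 2 * (n - y) / (n + 1) * (h n * (2 / c) ^ n) := by
      rw [pow_succ]
      field_simp
      linear_combination hrec n
    rw [h1, abs_mul (2 * ((n : ℝ) - y) / (n + 1))]
    refine le_mul_of_one_le_left (abs_nonneg _) ?_
    have h2 := le_abs_self y
    rw [abs_of_nonneg (div_nonneg (by linarith) hpos.le), le_div_iff₀ hpos]
    linarith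
  have hge : ∀ n, N ≤ n → |h N * (2 / c) ^ N| ≤ |h n * (2 / c) ^ n| := by
    intro n hn
    induction n, hn using Nat.le_induction with
    | base => exact le_rfl
    | succ n hn ih => exact ih.trans (hmono n hn)
  have hle : |h N * (2 / c) ^ N| ≤ 0 :=
    ge_of_tendsto (by simpa using hlim.abs) (Filter.eventually_atTop.2 ⟨N, hge⟩)
  have h2 : h N * (2 / c) ^ N ≠ 0 := mul_ne_zero (hne N) (pow_ne_zero _ (div_ne_zero two_ne_zero hc))
  exact h2 (abs_eq_zero.1 (le_antisymm hle (abs_nonneg _)))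

open PowerSeries in
/-- The exponential generating function of the `P_n(σ; x)`, divided by `exp (t / x)`. -/
noncomputable def reducedGenFun (σ ρ x : ℝ) : PowerSeries ℝ :=
  mk (fun n => polyP σ ρ x n / n.factorial) * mk (fun n => (-1 / x) ^ n / n.factorial)

open PowerSeries in
theorem genFun_ode {σ ρ : ℝ} (hρ : 0 < ρ) (x : ℝ) :
    (C ρ - C x * X) * d⁄dX ℝ (mk (fun n => polyP σ ρ x n / n.factorial)) =
      (C ((σ + ρ) * x) - X) * mk (fun n => polyP σ ρ x n / n.factorial) := by
  ext n
  rw [sub_mul, sub_mul, mul_assoc, map_sub, map_sub, coeff_C_mul, coeff_C_mul, coeff_C_mul,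
    coeff_derivative]
  cases n with
  | zero =>
    simp [polyP]
    field_simp
  | succ n =>
    rw [coeff_succ_X_mul, coeff_succ_X_mul, coeff_derivative]
    simp only [coeff_mk]
    rw [polyP, Nat.factorial_succ (n + 1), Nat.factorial_succ n]
    have h2 : (n.factorial : ℝ) ≠ 0 := by positivity
    have h3 : (n : ℝ) + 1 ≠ 0 := by positivity
    have h4 : (n : ℝ) + 1 + 1 ≠ 0 := by positivity
    push_cast
    field_simp
    ring

open PowerSeries in
theorem derivative_mk_exp (c : ℝ) :
    d⁄dX ℝ (mk (fun n => c ^ n / n.factorial)) = C c * mk (fun n => c ^ n / n.factorial) := by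
  ext n
  rw [coeff_derivative, coeff_C_mul, coeff_mk, coeff_mk, Nat.factorial_succ, pow_succ]
  have h2 : (n.factorial : ℝ) ≠ 0 := by positivity
  have h3 : (n : ℝ) + 1 ≠ 0 := by positivity
  push_cast
  field_simp

open PowerSeries in
-- Removing e^{t/x} makes the right side of the differential equation a constant multiple of the
-- series: (ρ - xt) h' = ((σ+ρ)x - ρ/x) h. Its coefficients obey a two-term recurrence.
theorem coeff_reducedGenFun_succ {σ ρ : ℝ} (hρ : 0 < ρ) {x : ℝ} (hx : x ≠ 0) (n : ℕ) :
    (n + 1) * coeff (n + 1) (reducedGenFun σ ρ x) =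
      x / ρ * (n - (ρ / x ^ 2 - (σ + ρ))) * coeff n (reducedGenFun σ ρ x) := by
  have hC : (C x : PowerSeries ℝ) * C (-1 / x) = -1 := by
    rw [← map_mul, mul_div_cancel₀ _ hx, map_neg, map_one]
  have hC2 : (C ((σ + ρ) * x - ρ / x) : PowerSeries ℝ) =
      C ((σ + ρ) * x) + C ρ * C (-1 / x) := by
    rw [← map_mul, ← map_add]
    congr 1
    ring
  have hode : (C ρ - C x * X) * d⁄dX ℝ (reducedGenFun σ ρ x) =
      C ((σ + ρ) * x - ρ / x) * reducedGenFun σ ρ x := by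
    rw [reducedGenFun, Derivation.leibniz, derivative_mk_exp, hC2]
    simp only [smul_eq_mul]
    linear_combination (mk (fun n => (-1 / x) ^ n / (n.factorial : ℝ))) *
      genFun_ode (σ := σ) hρ x - X * mk (fun n => polyP σ ρ x n / (n.factorial : ℝ)) *
        mk (fun n => (-1 / x) ^ n / (n.factorial : ℝ)) * hC
  have h := congrArg (coeff n) hode
  rw [sub_mul, mul_assoc, map_sub, coeff_C_mul, coeff_C_mul, coeff_C_mul, coeff_derivative] at h
  have h2 : coeff n (X * d⁄dX ℝ (reducedGenFun σ ρ x)) = n * coeff n (reducedGenFun σ ρ x) := by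
    cases n with
    | zero => simp
    | succ n =>
      rw [coeff_succ_X_mul, coeff_derivative]
      push_cast
      ring
  rw [h2] at h
  field_simp at h ⊢
  linear_combination h

open PowerSeries in
theorem summable_coeff_reducedGenFun {σ ρ : ℝ} (hσ : 0 < σ) (hρ : 0 < ρ) {x : ℝ}
    (hs : Summable fun n => weight σ ρ n * polyP σ ρ x n ^ 2) (t : ℝ) :
    Summable fun n => coeff n (reducedGenFun σ ρ x) * t ^ n := by
  have hg : Summable fun n => ‖polyP σ ρ x n / n.factorial * t ^ n‖ := by
    refine Summable.of_nonneg_of_le (fun n => norm_nonneg _) (fun n => ?_)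
      (hs.add (Real.summable_pow_div_factorial (t ^ 2 / ρ)))
    have h1 : ρ ^ n / n.factorial ≤ weight σ ρ n := by
      refine le_mul_of_one_le_left (by positivity) ?_
      rw [le_div_iff₀ (by positivity)]
      have : (0 : ℝ) ≤ n := n.cast_nonneg
      linarith
    -- The arithmetic-geometric mean inequality splits the term into a piece bounded by the norm of
    -- P(σ; x) and a piece of an exponential series, for every t.
    have h2 : |polyP σ ρ x n * t ^ n| ≤ ρ ^ n * polyP σ ρ x n ^ 2 + (t ^ 2 / ρ) ^ n := by
      have hr : 0 < ρ ^ n := by positivity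
      have h3 : (t ^ 2 / ρ) ^ n = (t ^ n) ^ 2 / ρ ^ n := by
        rw [div_pow, ← pow_mul, ← pow_mul, mul_comm]
      rw [h3, abs_mul, ← sq_abs (polyP σ ρ x n), ← sq_abs (t ^ n)]
      have h4 := sq_nonneg (ρ ^ n * |polyP σ ρ x n| - |t ^ n|)
      have h5 : 0 ≤ |polyP σ ρ x n| * |t ^ n| := by positivity
      have h6 : ρ ^ n * |polyP σ ρ x n| ^ 2 + |t ^ n| ^ 2 / ρ ^ n =
          ((ρ ^ n * |polyP σ ρ x n|) ^ 2 + |t ^ n| ^ 2) / ρ ^ n := by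
        field_simp
      rw [h6, le_div_iff₀ hr]
      nlinarith [mul_nonneg h5 hr.le]
    calc ‖polyP σ ρ x n / n.factorial * t ^ n‖
        = |polyP σ ρ x n * t ^ n| / n.factorial := by
          rw [Real.norm_eq_abs, div_mul_eq_mul_div, abs_div, Nat.abs_cast]
      _ ≤ (ρ ^ n * polyP σ ρ x n ^ 2 + (t ^ 2 / ρ) ^ n) / n.factorial := by gcongr
      _ = ρ ^ n / n.factorial * polyP σ ρ x n ^ 2 + (t ^ 2 / ρ) ^ n / n.factorial := by ring
      _ ≤ _ := by gcongr
  have he : Summable fun n => ‖(-1 / x) ^ n / n.factorial * t ^ n‖ := by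
    refine ((Real.summable_pow_div_factorial (-1 / x * t)).norm).congr fun n => ?_
    rw [mul_pow]
    ring_nf
  refine (summable_norm_sum_mul_antidiagonal_of_summable_norm hg he).of_norm.congr fun n => ?_
  rw [reducedGenFun, coeff_mul, Finset.sum_mul]
  refine Finset.sum_congr rfl fun p hp => ?_
  rw [← Finset.HasAntidiagonal.mem_antidiagonal.1 hp, pow_add, coeff_mk, coeff_mk]
  ring

/-- At x = 0, where e^{t/x} is not available, the recurrence gives the even terms explicitly, and
4^n ≤ 2n·binom(2n, n) keeps them away from zero. -/
theorem not_summable_polyP_zero {σ ρ : ℝ} (hσ : 0 < σ) (hρ : 0 < ρ) :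
    ¬ Summable fun n => weight σ ρ n * polyP σ ρ 0 n ^ 2 := by
  have hP : ∀ n : ℕ, polyP σ ρ 0 (2 * n) * (2 ^ n * n.factorial * ρ ^ n) =
      (-1) ^ n * (2 * n).factorial := by
    intro n
    induction n with
    | zero => simp [polyP]
    | succ n ih =>
      rw [show 2 * (n + 1) = 2 * n + 2 by ring, polyP, Nat.factorial_succ, Nat.factorial_succ,
        Nat.factorial_succ]
      push_cast
      field_simp
      linear_combination (-2 * ρ * ((n : ℝ) + 1) * (2 * n + 1)) * ih
  intro hs
  have hlow : ∀ n : ℕ, 1 ≤ n →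
      1 / (σ + ρ) ≤ weight σ ρ (2 * n) * polyP σ ρ 0 (2 * n) ^ 2 := by
    intro n hn
    have hb : (4 : ℝ) ^ n ≤ 2 * n * n.centralBinom := by
      exact_mod_cast Nat.four_pow_le_two_mul_self_mul_centralBinom n hn
    have hcb : (n.centralBinom : ℝ) * (n.factorial * n.factorial) = (2 * n).factorial := by
      have h := Nat.choose_mul_factorial_mul_factorial (show n ≤ 2 * n by omega)
      rw [show 2 * n - n = n by omega, mul_assoc] at h
      exact_mod_cast h
    have hf : (n.factorial : ℝ) ≠ 0 := by positivity
    have hp : polyP σ ρ 0 (2 * n) =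
        (-1) ^ n * (2 * n).factorial / (2 ^ n * n.factorial * ρ ^ n) := by
      rw [eq_div_iff (by positivity), hP]
    have h4 : (4 : ℝ) ^ n = (2 ^ n) ^ 2 := by rw [← pow_mul, mul_comm, pow_mul]; norm_num
    have h1 : weight σ ρ (2 * n) * polyP σ ρ 0 (2 * n) ^ 2 =
        (σ + ρ + 2 * n) * n.centralBinom / 4 ^ n / (σ + ρ) := by
      rw [weight, hp, div_pow, mul_pow ((-1) ^ n), ← pow_mul (-1 : ℝ), mul_comm n 2,
        pow_mul (-1 : ℝ) 2, ← hcb, h4]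
      have : (n.centralBinom : ℝ) ≠ 0 := by exact_mod_cast n.centralBinom_ne_zero
      push_cast
      field_simp
      ring
    rw [h1]
    gcongr
    rw [le_div_iff₀ (by positivity), one_mul]
    refine hb.trans ?_
    gcongr
    linarith
  have hz := (hs.tendsto_atTop_zero).comp
    (Filter.tendsto_id.const_mul_atTop' (zero_lt_two : (0 : ℕ) < 2))
  have hle : 1 / (σ + ρ) ≤ 0 :=
    ge_of_tendsto hz (Filter.eventually_atTop.2 ⟨1, fun n hn => hlow n hn⟩)
  have : 0 < 1 / (σ + ρ) := by positivity
  linarith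

/-- The sequence `P(σ; x)` lies in the weighted space only for the listed `x`. -/
theorem exists_sq_eq_of_summable {σ ρ : ℝ} (hσ : 0 < σ) (hρ : 0 < ρ) {x : ℝ}
    (hs : Summable fun n => weight σ ρ n * polyP σ ρ x n ^ 2) :
    ∃ k : ℕ, x ^ 2 = ρ / (σ + ρ + k) := by
  have hx : x ≠ 0 := by
    rintro rfl
    exact not_summable_polyP_zero hσ hρ hs
  obtain ⟨k, hk⟩ := exists_natCast_eq_of_hypergeometric
    (h := fun n => PowerSeries.coeff n (reducedGenFun σ ρ x)) (c := x / ρ) (div_ne_zero hx hρ.ne')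
    (by simp [reducedGenFun, polyP])
    (coeff_reducedGenFun_succ hρ hx)
    -- The point t is 2/c with c = x/ρ.
    (summable_coeff_reducedGenFun hσ hρ hs _).tendsto_atTop_zero
  refine ⟨k, ?_⟩
  have h1 : σ + ρ + k ≠ 0 := by positivity
  have h2 : σ + ρ + k = ρ / x ^ 2 := by linarith
  rw [eq_div_iff h1, h2]
  field_simp

/-! ### The atoms and the basis of eigenvectors -/

theorem measurable_polyP (σ ρ : ℝ) (n : ℕ) : Measurable fun x => polyP σ ρ x n := by
  induction n using Nat.twoStepInduction with
  | zero => exact measurable_const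
  | one =>
    simp only [polyP]
    fun_prop
  | more n h1 h2 =>
    simp only [polyP]
    fun_prop

/-- The points `s_k^±`, indexed by `k` and the sign. -/
noncomputable def signedAtom (σ ρ : ℝ) (i : ℕ × Bool) : ℝ :=
  if i.2 then atom σ ρ i.1 else -atom σ ρ i.1

theorem range_signedAtom (σ ρ : ℝ) : Set.range (signedAtom σ ρ) = atoms σ ρ := by
  ext x
  simp only [Set.mem_range, Prod.exists, Bool.exists_bool, atoms, Set.mem_ofPred_eq, signedAtom]
  refine exists_congr fun k => ?_
  simp only [Bool.false_eq_true, if_false, if_true, @eq_comm ℝ x]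
  exact or_comm

theorem measurableSet_atoms (σ ρ : ℝ) : MeasurableSet (atoms σ ρ) := by
  rw [← range_signedAtom]
  exact (Set.countable_range _).measurableSet

theorem discreteMeasure_eq (σ ρ : ℝ) : discreteMeasure σ ρ =
    Measure.sum fun i : ℕ × Bool =>
      ENNReal.ofReal (mass σ ρ i.1) • Measure.dirac (signedAtom σ ρ i) := by
  ext B hB
  rw [discreteMeasure, Measure.sum_apply _ hB, Measure.sum_apply _ hB, ENNReal.summable.tsum_prod' fun _ => ENNReal.summable]
  refine tsum_congr fun k => ?_
  rw [tsum_bool]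
  simp [signedAtom, add_comm]

section Eigenvectors

variable {σ ρ : ℝ} (hσ : 0 < σ) (hρ : 0 < ρ)

include hσ hρ

theorem atom_pos (k : ℕ) : 0 < atom σ ρ k := Real.sqrt_pos.2 (by positivity)

theorem atom_sq (k : ℕ) : atom σ ρ k ^ 2 = ρ / (σ + ρ + k) := Real.sq_sqrt (by positivity)

theorem signedAtom_sq (i : ℕ × Bool) : signedAtom σ ρ i ^ 2 = ρ / (σ + ρ + i.1) := by
  rw [signedAtom]
  split_ifs
  · exact atom_sq hσ hρ _
  · rw [neg_sq, atom_sq hσ hρ]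

theorem signedAtom_injective : Function.Injective (signedAtom σ ρ) := by
  rintro ⟨k, a⟩ ⟨l, b⟩ h
  have h1 : k = l := by
    have h2 := congrArg (· ^ 2) h
    simp only [signedAtom_sq hσ hρ] at h2
    have h3 : σ + ρ + k ≠ 0 := by positivity
    have h4 : σ + ρ + l ≠ 0 := by positivity
    rw [div_eq_div_iff h3 h4] at h2
    have h5 : (k : ℝ) = l := by linarith [mul_left_cancel₀ hρ.ne' h2]
    exact_mod_cast h5
  subst h1
  have hk := atom_pos hσ hρ k
  cases a <;> cases b <;> simp [signedAtom] at h ⊢ <;> linarith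

theorem exists_signedAtom_eq {x : ℝ} {k : ℕ} (hx : x ^ 2 = ρ / (σ + ρ + k)) :
    ∃ i, x = signedAtom σ ρ i := by
  rw [← atom_sq hσ hρ] at hx
  rcases sq_eq_sq_iff_eq_or_eq_neg.1 hx with h | h
  · exact ⟨(k, true), by simpa [signedAtom] using h⟩
  · exact ⟨(k, false), by simpa [signedAtom] using h⟩

theorem discreteMeasure_singleton (i : ℕ × Bool) :
    discreteMeasure σ ρ {signedAtom σ ρ i} = ENNReal.ofReal (mass σ ρ i.1) := by
  rw [discreteMeasure_eq, Measure.sum_apply _ (measurableSet_singleton _), tsum_eq_single i]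
  · simp
  · intro j hj
    simp [(signedAtom_injective hσ hρ).ne hj]

theorem summable_of_eigenvector {x : ℝ} {f : HSpace σ ρ} (hf : ∀ n, f n = f 0 * polyP σ ρ x n)
    (hne : f ≠ 0) : Summable fun n => weight σ ρ n * polyP σ ρ x n ^ 2 := by
  have h0 : f 0 ≠ 0 := fun h0 => hne <| HSpace.ext_coe fun n => by
    rw [hf, h0, zero_mul, HSpace.zero_apply hσ hρ]
  refine ((HSpace.hasSum_norm_sq hσ hρ f).summable.mul_left (1 / f 0 ^ 2)).congr fun n => ?_
  rw [hf n]
  field_simp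

variable {A : HSpace σ ρ →L[ℝ] HSpace σ ρ} (hA0 : ∀ f, A f 0 = ρ / (σ + ρ) * f 1)
  (hA : ∀ f (n : ℕ), A f (n + 1) = ρ / ((n + 1 : ℕ) + σ + ρ) * f (n + 2) +
        ((n + 1 : ℕ) : ℝ) / ((n + 1 : ℕ) + σ + ρ) * f n)

include hA0 hA

theorem apply_eq_smul_iff {x : ℝ} {f : HSpace σ ρ} :
    A f = x • f ↔ ∀ n, f n = f 0 * polyP σ ρ x n := by
  have hs : σ + ρ ≠ 0 := by positivity
  constructor
  · intro h n
    have hc : ∀ n, A f n = x * f n := fun n => by rw [h, HSpace.smul_apply hσ hρ]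
    induction n using Nat.twoStepInduction with
    | zero => simp [polyP]
    | one =>
      have h1 := hc 0
      rw [hA0] at h1
      rw [polyP]
      field_simp at h1 ⊢
      linear_combination h1
    | more n ih1 ih2 =>
      have h1 := hc (n + 1)
      have h2 : ((n + 1 : ℕ) : ℝ) + σ + ρ ≠ 0 := by positivity
      rw [hA, ih2, ih1] at h1
      rw [polyP]
      push_cast at h1 h2
      field_simp at h1 ⊢
      linear_combination h1
  · intro h
    refine HSpace.ext_coe fun n => ?_
    rw [HSpace.smul_apply hσ hρ]
    cases n with
    | zero =>
      rw [hA0, h 1, polyP]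
      field_simp
    | succ n =>
      have h2 : ((n + 1 : ℕ) : ℝ) + σ + ρ ≠ 0 := by positivity
      rw [hA, h (n + 2), h (n + 1), h n, polyP]
      push_cast at h2 ⊢
      field_simp
      ring

/-- There is an orthonormal basis of eigenvectors, which are multiples of the `P(σ; s_k^±)`. -/
theorem exists_hilbertBasis (hsa : IsSelfAdjoint A) (hcomp : IsCompactOperator A) :
    ∃ b : HilbertBasis (ℕ × Bool) ℝ (HSpace σ ρ),
      (∀ i, A (b i) = signedAtom σ ρ i • b i) ∧
      ∀ i n, b i n = √(mass σ ρ i.1) * polyP σ ρ (signedAtom σ ρ i) n := by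
  have hsum := fun i : ℕ × Bool => hasSum_weight_mul_polyP_sq hσ hρ (signedAtom_sq hσ hρ i)
  choose p hp using fun i => HSpace.exists_of_summable hσ hρ (hsum i).summable
  have hnorm : ∀ i, ‖p i‖ ^ 2 = 1 / mass σ ρ i.1 := by
    intro i
    refine (HSpace.hasSum_norm_sq hσ hρ (p i)).unique ?_
    simpa only [hp] using hsum i
  have hAp : ∀ i, A (p i) = signedAtom σ ρ i • p i := by
    intro i
    rw [apply_eq_smul_iff hσ hρ hA0 hA]
    intro n
    rw [hp, hp]
    simp [polyP]
  let v : ℕ × Bool → HSpace σ ρ := fun i => √(mass σ ρ i.1) • p i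
  have hAv : ∀ i, A (v i) = signedAtom σ ρ i • v i := by
    intro i
    simp only [v]
    rw [map_smul, hAp, smul_comm]
  have hv : Orthonormal ℝ v := by
    refine ⟨fun i => ?_, fun i j hij => ?_⟩
    · rw [← sq_eq_sq₀ (norm_nonneg _) zero_le_one, norm_smul, mul_pow, hnorm, Real.norm_eq_abs,
        sq_abs, Real.sq_sqrt (mass_pos hσ hρ _).le, mul_one_div_cancel (mass_pos hσ hρ _).ne',
        one_pow]
    · have h1 : ⟪A (v i), v j⟫_ℝ = ⟪v i, A (v j)⟫_ℝ := hsa.isSymmetric _ _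
      rw [hAv, hAv, inner_smul_left, inner_smul_right _ (v j), conj_trivial] at h1
      have h2 := sub_ne_zero.2 ((signedAtom_injective hσ hρ).ne hij)
      refine (mul_eq_zero.1 (?_ : (signedAtom σ ρ i - signedAtom σ ρ j) * ⟪v i, v j⟫_ℝ = 0)
        ).resolve_left h2
      rw [sub_mul, h1, sub_self]
  -- By the spectral theorem for compact self-adjoint operators it suffices that every eigenspace
  -- lies in the span of the `v i`.
  have hspan : (Submodule.span ℝ (Set.range v))ᗮ = ⊥ := by
    rw [eq_bot_iff, ← ContinuousLinearMap.orthogonalComplement_iSup_eigenspaces_eq_bot hcomp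
      hsa.isSymmetric]
    refine Submodule.orthogonal_le (iSup_le fun x f hf => ?_)
    have hf1 := (apply_eq_smul_iff hσ hρ hA0 hA).1 (Module.End.mem_eigenspace_iff.1 hf)
    by_cases h0 : f = 0
    · rw [h0]
      exact zero_mem _
    · have hs := summable_of_eigenvector hσ hρ hf1 h0
      obtain ⟨k, hk⟩ := exists_sq_eq_of_summable hσ hρ hs
      obtain ⟨i, rfl⟩ := exists_signedAtom_eq hσ hρ hk
      have hm := Real.sqrt_ne_zero'.2 (mass_pos hσ hρ i.1)
      have h2 : f = (f 0 / √(mass σ ρ i.1)) • v i := HSpace.ext_coe fun n => by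
        rw [HSpace.smul_apply hσ hρ, HSpace.smul_apply hσ hρ, hp, hf1 n]
        field_simp
      rw [h2]
      exact Submodule.smul_mem _ _ (Submodule.subset_span ⟨i, rfl⟩)
  refine ⟨HilbertBasis.mkOfOrthogonalEqBot hv hspan, fun i => ?_, fun i n => ?_⟩
  · rw [HilbertBasis.coe_mkOfOrthogonalEqBot]
    exact hAv i
  · rw [HilbertBasis.coe_mkOfOrthogonalEqBot, HSpace.smul_apply hσ hρ, hp]

end Eigenvectors

/-! ### Orthogonality relations and the scalar spectral measure -/

section Basis

variable {σ ρ : ℝ} (hσ : 0 < σ) (hρ : 0 < ρ) {b : HilbertBasis (ℕ × Bool) ℝ (HSpace σ ρ)}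
  (hb : ∀ i n, b i n = √(mass σ ρ i.1) * polyP σ ρ (signedAtom σ ρ i) n)

include hσ hρ hb

theorem inner_basis_basisVec (i : ℕ × Bool) (n : ℕ) : ⟪b i, basisVec σ ρ n⟫_ℝ =
    weight σ ρ n * (√(mass σ ρ i.1) * polyP σ ρ (signedAtom σ ρ i) n) := by
  rw [real_inner_comm, HSpace.inner_basisVec hσ hρ, hb]

/-- Parseval for e_n and e_m in the eigenbasis, divided by π_n π_m. -/
theorem hasSum_mass_mul_polyP (n m : ℕ) :
    HasSum (fun i : ℕ × Bool => mass σ ρ i.1 *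
      (polyP σ ρ (signedAtom σ ρ i) n * polyP σ ρ (signedAtom σ ρ i) m))
      (if n = m then 1 / weight σ ρ n else 0) := by
  have hn := (weight_pos hσ hρ n).ne'
  have hm := (weight_pos hσ hρ m).ne'
  have h := (b.hasSum_inner_mul_inner (basisVec σ ρ n) (basisVec σ ρ m)).mul_left
    (1 / (weight σ ρ n * weight σ ρ m))
  convert! h using 1
  · funext i
    rw [real_inner_comm, inner_basis_basisVec hσ hρ hb, inner_basis_basisVec hσ hρ hb]
    field_simp
    rw [Real.sq_sqrt (mass_pos hσ hρ i.1).le]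
    ring
  · rw [HSpace.inner_basisVec hσ hρ, HSpace.basisVec_apply hσ hρ]
    by_cases hnm : n = m
    · subst hnm
      simp only [if_true]
      field_simp
    · simp [hnm]

theorem scalarMeasure_diagonalPVM_basisVec_zero :
    (diagonalPVM b (signedAtom σ ρ)).scalarMeasure (basisVec σ ρ 0) = discreteMeasure σ ρ := by
  rw [scalarMeasure_diagonalPVM, discreteMeasure_eq]
  congr 1
  funext i
  rw [inner_basis_basisVec hσ hρ hb, weight_zero hσ hρ]
  simp [polyP, Real.sq_sqrt (mass_pos hσ hρ i.1).le]

omit hb in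
-- The signed atoms are pairwise distinct, so only one basis vector carries the given label.
theorem diagonalPVM_singleton {i : ℕ × Bool} {p : HSpace σ ρ} {c : ℝ} (hc : c ≠ 0)
    (hp : b i = c • p) : (diagonalPVM b (signedAtom σ ρ)).proj {signedAtom σ ρ i} =
      (Submodule.span ℝ {p}).starProjection := by
  refine b.clm_ext fun j => ?_
  rcases eq_or_ne j i with rfl | hj
  · rw [diagonalPVM_apply_of_mem b _ (measurableSet_singleton _) rfl, eq_comm,
      Submodule.starProjection_eq_self_iff, hp]
    exact Submodule.smul_mem _ _ (Submodule.mem_span_singleton_self p)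
  · rw [diagonalPVM_apply_of_notMem b _ (measurableSet_singleton _)
        ((signedAtom_injective hσ hρ).ne hj), eq_comm, Submodule.starProjection_apply_eq_zero_iff,
      Submodule.mem_orthogonal_singleton_iff_inner_right]
    have h : ⟪b i, b j⟫_ℝ = 0 := b.orthonormal.2 hj.symm
    rw [hp, inner_smul_left] at h
    exact (mul_eq_zero.1 h).resolve_left (by simpa using hc)

end Basis

end MMInf

/-! ### The main theorem -/

theorem mainTheorem3 (σ ρ : ℝ) (hσ : 0 < σ) (hρ : 0 < ρ) :
    -- the matrix induces a bounded self-adjoint operator on the weighted space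
    ∃ A : MMInf.HSpace σ ρ →L[ℝ] MMInf.HSpace σ ρ,
      (∀ (f : MMInf.HSpace σ ρ) (n : ℕ), A f n = ∑' m : ℕ, MMInf.matrixEntry σ ρ n m * f m) ∧
      IsSelfAdjoint A ∧
      -- it has a unique spectral measure `E`
      (∃ E : MMInf.ProjectionValuedMeasure (MMInf.HSpace σ ρ),
        E.IsSpectralMeasureOf A ∧
        (∀ E' : MMInf.ProjectionValuedMeasure (MMInf.HSpace σ ρ),
          E'.IsSpectralMeasureOf A → E' = E) ∧
        -- which is purely discrete, carried by the points `s_k^±`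
        E.proj (MMInf.atoms σ ρ)ᶜ = 0 ∧
        E.scalarMeasure (MMInf.basisVec σ ρ 0) = MMInf.discreteMeasure σ ρ ∧
        (∀ k : ℕ,
          E.scalarMeasure (MMInf.basisVec σ ρ 0) {MMInf.atom σ ρ k}
            = ENNReal.ofReal (MMInf.mass σ ρ k) ∧
          E.scalarMeasure (MMInf.basisVec σ ρ 0) {-MMInf.atom σ ρ k}
            = ENNReal.ofReal (MMInf.mass σ ρ k)) ∧
        -- the eigenvectors are the `P(σ; s_k^±)`
        (∀ x ∈ MMInf.atoms σ ρ, ∃ p : MMInf.HSpace σ ρ,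
          (∀ n : ℕ, p n = MMInf.polyP σ ρ x n) ∧
          Module.End.HasEigenvector (A : Module.End ℝ (MMInf.HSpace σ ρ)) x p ∧
          Module.End.eigenspace (A : Module.End ℝ (MMInf.HSpace σ ρ)) x
            = Submodule.span ℝ {p} ∧
          E.proj {x} = (Submodule.span ℝ {p}).starProjection)) ∧
      (∀ x : ℝ, Module.End.HasEigenvalue (A : Module.End ℝ (MMInf.HSpace σ ρ)) x ↔
        x ∈ MMInf.atoms σ ρ) ∧
      -- the same measure is the orthogonality measure of the polynomials `P_n(σ; x)`
      (∀ n m : ℕ,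
        MeasureTheory.Integrable (fun x => MMInf.polyP σ ρ x n * MMInf.polyP σ ρ x m)
          (MMInf.discreteMeasure σ ρ) ∧
        ∫ x, MMInf.polyP σ ρ x n * MMInf.polyP σ ρ x m ∂(MMInf.discreteMeasure σ ρ)
          = if n = m then 1 / MMInf.weight σ ρ n else 0) ∧
      -- which are given through the Charlier polynomials
      (∀ (n : ℕ) (x : ℝ), x ≠ 0 →
        MMInf.polyP σ ρ x n = 1 / x ^ n *
          MMInf.charlier (ρ / x ^ 2) ((ρ - (σ + ρ) * x ^ 2) / x ^ 2) n) := by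
  obtain ⟨A, hsa, hcomp, hA0, hA⟩ := MMInf.HSpace.exists_matrix_operator hσ hρ
  obtain ⟨b, hAb, hb⟩ := MMInf.exists_hilbertBasis hσ hρ hA0 hA hsa hcomp
  have hscalar := MMInf.scalarMeasure_diagonalPVM_basisVec_zero hσ hρ hb
  have heig : ∀ x ∈ MMInf.atoms σ ρ, ∃ p : MMInf.HSpace σ ρ,
      (∀ n : ℕ, p n = MMInf.polyP σ ρ x n) ∧
      Module.End.HasEigenvector (A : Module.End ℝ (MMInf.HSpace σ ρ)) x p ∧
      Module.End.eigenspace (A : Module.End ℝ (MMInf.HSpace σ ρ)) x = Submodule.span ℝ {p} ∧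
      (MMInf.diagonalPVM b (MMInf.signedAtom σ ρ)).proj {x} =
        (Submodule.span ℝ {p}).starProjection := by
    rw [← MMInf.range_signedAtom]
    rintro _ ⟨i, rfl⟩
    obtain ⟨p, hp⟩ := MMInf.HSpace.exists_of_summable hσ hρ
      (MMInf.hasSum_weight_mul_polyP_sq hσ hρ (MMInf.signedAtom_sq hσ hρ i)).summable
    have hp0 : p 0 = 1 := by rw [hp, MMInf.polyP]
    have hAp : A p = MMInf.signedAtom σ ρ i • p := by
      rw [MMInf.apply_eq_smul_iff hσ hρ hA0 hA]
      intro n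
      rw [hp0, hp, one_mul]
    have hpne : p ≠ 0 := by
      rintro rfl
      rw [MMInf.HSpace.zero_apply hσ hρ] at hp0
      exact zero_ne_one hp0
    refine ⟨p, hp, ⟨Module.End.mem_eigenspace_iff.2 hAp, hpne⟩, ?_, ?_⟩
    · ext f
      rw [Module.End.mem_eigenspace_iff, Submodule.mem_span_singleton]
      constructor
      · intro hf
        refine ⟨f 0, MMInf.HSpace.ext_coe fun n => ?_⟩
        rw [MMInf.HSpace.smul_apply hσ hρ, hp,
          (MMInf.apply_eq_smul_iff hσ hρ hA0 hA).1 hf n]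
      · rintro ⟨c, rfl⟩
        rw [map_smul, smul_comm]
        exact congrArg (c • ·) hAp
    · refine MMInf.diagonalPVM_singleton hσ hρ
        (Real.sqrt_ne_zero'.2 (MMInf.mass_pos hσ hρ i.1)) (MMInf.HSpace.ext_coe fun n => ?_)
      rw [MMInf.HSpace.smul_apply hσ hρ, hp, hb]
  refine ⟨A, fun f n => ?_, hsa,
    ⟨MMInf.diagonalPVM b (MMInf.signedAtom σ ρ), MMInf.isSpectralMeasureOf_diagonalPVM hsa hAb,
      fun E' hE' => MMInf.eq_diagonalPVM hAb hE', ?_, hscalar, fun k => ?_, heig⟩,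
    fun x => ⟨fun hx => ?_, fun hx => ?_⟩, fun n m => ?_,
    fun n x hx => MMInf.polyP_eq_charlier hρ hx n⟩
  · cases n with
    | zero => rw [MMInf.tsum_matrixEntry_zero, hA0]
    | succ n => rw [MMInf.tsum_matrixEntry_succ, hA]
  -- All diagonal labels are atoms, so the projection of the complement kills every basis vector.
  · refine b.clm_ext fun i => ?_
    rw [MMInf.diagonalPVM_apply_of_notMem b _ (MMInf.measurableSet_atoms σ ρ).compl]
    · rfl
    · rw [Set.notMem_compl_iff, ← MMInf.range_signedAtom]
      exact ⟨i, rfl⟩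
  · rw [hscalar]
    exact ⟨MMInf.discreteMeasure_singleton hσ hρ (k, true),
      MMInf.discreteMeasure_singleton hσ hρ (k, false)⟩
  · obtain ⟨f, hf, hf0⟩ := hx.exists_hasEigenvector
    have hfn := (MMInf.apply_eq_smul_iff hσ hρ hA0 hA).1 (Module.End.mem_eigenspace_iff.1 hf)
    obtain ⟨k, hk⟩ := MMInf.exists_sq_eq_of_summable hσ hρ
      (MMInf.summable_of_eigenvector hσ hρ hfn hf0)
    rw [← MMInf.range_signedAtom]
    obtain ⟨i, rfl⟩ := MMInf.exists_signedAtom_eq hσ hρ hk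
    exact ⟨i, rfl⟩
  · obtain ⟨p, -, hp, -⟩ := heig x hx
    exact Module.End.hasEigenvalue_of_hasEigenvector hp
  · have h := MMInf.hasSum_mass_mul_polyP hσ hρ hb n m
    have hm : ∀ i : ℕ × Bool, 0 ≤ MMInf.mass σ ρ i.1 := fun i => (MMInf.mass_pos hσ hρ i.1).le
    have hf : Measurable fun x => MMInf.polyP σ ρ x n * MMInf.polyP σ ρ x m :=
      (MMInf.measurable_polyP σ ρ n).mul (MMInf.measurable_polyP σ ρ m)
    rw [MMInf.discreteMeasure_eq]
    exact ⟨MMInf.integrable_sum_dirac hm hf h.summable, MMInf.integral_sum_dirac hm hf h⟩
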